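/- Conventions. All manifolds and tensor fields are smooth and manifolds are connected. For a semi-Riemannian metric $g$ with Levi-Civita connection $\nabla$ put $R(X,Y)Z=\nabla_X\nabla_YZ-\nabla_Y\nabla_XZ-\nabla_{[X,Y]}Z$, and $2\,d\eta(X,Y)=X\eta(Y)-Y\eta(X)-\eta([X,Y])$ for a 1-form $\eta$. Let $M$ be a manifold of dimension $2n+s$ with $n,s\ge 1$. An indefinite globally framed $f$-structure $(\varphi,\xi_\alpha,\eta^\alpha,g)$, $\alpha\in\{1,\dots,s\}$, on $M$ consists of a nowhere vanishing $(1,1)$-tensor field $\varphi$, vector fields $\xi_\alpha$ that span $\ker\varphi$ at every point, 1-forms $\eta^\alpha$ and a semi-Riemannian metric $g$ such that $$\varphi^2=-I+\sum_\alpha\eta^\alpha\otimes\xi_\alpha,\qquad \eta^\alpha(\xi_\beta)=\delta^\alpha_\beta,\qquad g(\varphi X,\varphi Y)=g(X,Y)-\sum_\alpha\varepsilon_\alpha\eta^\alpha(X)\eta^\alpha(Y),$$ where $\varepsilon_\alpha=1$ if $\xi_\alpha$ is spacelike and $\varepsilon_\alpha=-1$ if $\xi_\alpha$ is timelike. It is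 an indefinite $\mathcal S$-structure if $N_\varphi+2\sum_\alpha d\eta^\alpha\otimes\xi_\alpha=0$, where $N_\varphi$ is the Nijenhuis torsion of $\varphi$, and $d\eta^\alpha(X,Y)=g(X,\varphi Y)$ for every $\alpha$; it is Lorentz if $g$ has signature $(-,+,\dots,+)$. It has constant $\varphi$-sectional curvature $c$ if for every $p\in M$ and every $X\in\operatorname{Im}\varphi_p$ with $g(X,X)\ne0$ the plane spanned by $X$ and $\varphi X$ has sectional curvature $c$. For a null vector $u\in T_pM$ the Jacobi operator $\bar R_u$ is the endomorphism of $u^\perp/\operatorname{span}\{u\}$ sending the class of $x$ to the class of $R(x,u)u$. Let $$N_\varphi((\xi_1)_p)=\{(\xi_1)_p+x \mid x\in\operatorname{Im}\varphi_p,\ g(x,(\xi_1)_p)=0,\ g(x,x)=1\}.$$ $M$ is $\varphi$-null Osserman with respect to $(\xi_1)_p$ at $p$ if the characteristic polynomial of $\bar R_u$ is the same for all $u\in N_\varphi((\xi_1)_p)$, and globally $\varphi$-null Osserman with respect to $\xi_1$ if this holds at every $p$ and the polynomial does not depend on $p$ either. Theorem. Let $(M,\varphi,\xi_\alpha,\eta^\alpha,g)$,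 $\dim M=2n+s$, be a Lorentz $\mathcal S$-manifold with $\xi_1$ timelike and constant $\varphi$-sectional curvature $c$. Then $M$ is $\varphi$-null Osserman with respect to $(\xi_1)_p$ at every point $p\in M$, and it is globally $\varphi$-null Osserman with respect to $\xi_1$. More precisely, for every $p\in M$ and every $u\in N_\varphi((\xi_1)_p)$ the map $x\mapsto R(x,u)u$ preserves $u^\perp$, so that $\bar R_u$ is well defined, and the characteristic polynomial of $\bar R_u$ is $$(t-(c+1))\Bigl(t-\tfrac{c+3s-2}{4}\Bigr)^{2n-2}\,t^{\,s-2}\,(t-(s-1))\quad\text{if } s\ge2,\qquad (t-(c+1))\Bigl(t-\tfrac{c+1}{4}\Bigr)^{2n-2}\quad\text{if } s=1.$$ Thus the eigenvalues of $\bar R_u$ are exactly $c+1$, $\frac{c+3s-2}{4}$ (if $n\ge2$), $s-1$ (if $s\ge2$) and $0$ (if $s\ge3$), up to coincidences among these numbers. -/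

import Mathlib

set_option maxSynthPendingDepth 3

open Bundle Set
open scoped Manifold ContDiff Polynomial

noncomputable section

namespace PhiNull

/-! ### Curvature of a metric given by its coefficients on an open subset of a vector space -/

section Local

variable {E : Type*} [NormedAddCommGroup E] [NormedSpace ℝ E]

/-- Christoffel symbols of the first kind of the metric coefficients `G` at `y`:
`(v, w, z) ↦ (∂_v G(w, z) + ∂_w G(v, z) - ∂_z G(v, w)) / 2`. -/
def christoffelLower (G : E → E →L[ℝ] E →L[ℝ] ℝ) (y : E) : E →L[ℝ] E →L[ℝ] E →L[ℝ] ℝ :=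
  let D : E →L[ℝ] E →L[ℝ] E →L[ℝ] ℝ := fderiv ℝ G y
  let D' : E →L[ℝ] E →L[ℝ] E →L[ℝ] ℝ :=
    (ContinuousLinearMap.flipₗᵢ ℝ E E ℝ).toContinuousLinearEquiv.toContinuousLinearMap ∘L D.flip
  (1 / 2 : ℝ) • (D + D.flip - D')

theorem christoffelLower_apply (G : E → E →L[ℝ] E →L[ℝ] ℝ) (y v w z : E) :
    christoffelLower G y v w z =
      (1 / 2 : ℝ) * (fderiv ℝ G y v w z + fderiv ℝ G y w v z - fderiv ℝ G y z v w) := by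
  simp [christoffelLower]

/-- Christoffel symbols of the second kind: `Γ_y(v, w)` is the vector with
`G_y(Γ_y(v, w), z) = christoffelLower G y v w z` for all `z` (index raised by the inverse of the
metric, seen as a map from `E` to its dual). The Levi-Civita connection is
`(∇_X W)(y) = DW(y)(X y) + Γ_y(X y, W y)`. -/
def christoffel (G : E → E →L[ℝ] E →L[ℝ] ℝ) (y : E) : E →L[ℝ] E →L[ℝ] E :=
  ContinuousLinearMap.compL ℝ E (E →L[ℝ] ℝ) E (G y).inverse ∘L christoffelLower G y

/-- The curvature `R(v, w) z = ∇_v ∇_w z - ∇_w ∇_v z` at `y` of the Levi-Civita connection, where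
`v`, `w`, `z` are extended as constant (hence commuting) vector fields. -/
def localCurvature (G : E → E →L[ℝ] E →L[ℝ] ℝ) (y v w z : E) : E :=
  (fderiv ℝ (christoffel G) y v w z + christoffel G y v (christoffel G y w z)) -
    (fderiv ℝ (christoffel G) y w v z + christoffel G y w (christoffel G y v z))

end Local

variable (E : Type*) [NormedAddCommGroup E] [NormedSpace ℝ E]
  (M : Type*) [TopologicalSpace M] [ChartedSpace E M]

/-! ### Smooth tensor fields and semi-Riemannian metrics -/

/-- A smooth semi-Riemannian metric on `M`. -/
structure SemiRiemannianMetric [IsManifold 𝓘(ℝ, E) ∞ M] where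
  /-- the scalar product on each tangent space -/
  val (p : M) : TangentSpace 𝓘(ℝ, E) p →L[ℝ] TangentSpace 𝓘(ℝ, E) p →L[ℝ] ℝ
  symm (p : M) (v w : TangentSpace 𝓘(ℝ, E) p) : val p v w = val p w v
  nondegenerate (p : M) (v : TangentSpace 𝓘(ℝ, E) p) (hv : ∀ w, val p v w = 0) : v = 0
  smooth : ContMDiff 𝓘(ℝ, E) (𝓘(ℝ, E).prod 𝓘(ℝ, E →L[ℝ] E →L[ℝ] ℝ)) ∞
    (fun p ↦ TotalSpace.mk' (E →L[ℝ] E →L[ℝ] ℝ)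
      (E := fun p : M ↦ TangentSpace 𝓘(ℝ, E) p →L[ℝ] TangentSpace 𝓘(ℝ, E) p →L[ℝ] ℝ) p (val p))

variable {E M}

/-- The vector field `X` is smooth at `p`. -/
def SmoothFieldAt [IsManifold 𝓘(ℝ, E) ∞ M] (X : Π p : M, TangentSpace 𝓘(ℝ, E) p) (p : M) : Prop :=
  ContMDiffAt 𝓘(ℝ, E) (𝓘(ℝ, E).prod 𝓘(ℝ, E)) ∞
    (fun q ↦ TotalSpace.mk' E (E := fun q : M ↦ TangentSpace 𝓘(ℝ, E) q) q (X q)) p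

namespace SemiRiemannianMetric

variable [IsManifold 𝓘(ℝ, E) ∞ M] (g : SemiRiemannianMetric E M)

/-- `g` is Lorentzian, of signature `(-, +, …, +)`: every tangent space is the orthogonal sum of a
negative definite line and a positive definite hyperplane. -/
def IsLorentz : Prop :=
  ∀ p : M, ∃ z : TangentSpace 𝓘(ℝ, E) p, g.val p z z < 0 ∧
    ∀ v : TangentSpace 𝓘(ℝ, E) p, g.val p z v = 0 → v ≠ 0 → 0 < g.val p v v

/-- The coefficients of `g` in the preferred chart at `p`, i.e. the pull-back of `g` by the inverse
of the chart (meaningful on the target of the chart, an open set). -/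
def chartCoeff (p : M) (y : E) : E →L[ℝ] E →L[ℝ] ℝ :=
  let q : M := (extChartAt 𝓘(ℝ, E) p).symm y
  let A : E →L[ℝ] TangentSpace 𝓘(ℝ, E) q :=
    mfderiv 𝓘(ℝ, E) 𝓘(ℝ, E) (extChartAt 𝓘(ℝ, E) p).symm y
  A.precomp ℝ ∘L g.val q ∘L A

/-- The curvature tensor `R_p(v, w) z` of the Levi-Civita connection of `g`, with the convention
`R(X, Y) Z = ∇_X ∇_Y Z - ∇_Y ∇_X Z - ∇_[X,Y] Z`. It is computed in the preferred chart at `p`,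
whose differential at `p` is the identification of `T_p M` with `E`. -/
def curvature (p : M) (v w z : TangentSpace 𝓘(ℝ, E) p) : TangentSpace 𝓘(ℝ, E) p :=
  localCurvature (E := E) (g.chartCoeff p) (extChartAt 𝓘(ℝ, E) p p) v w z

/-- The sectional curvature of the (non-degenerate) plane spanned by `v`, `w`. -/
def sectionalCurvature (p : M) (v w : TangentSpace 𝓘(ℝ, E) p) : ℝ :=
  g.val p (g.curvature p v w w) v / (g.val p v v * g.val p w w - g.val p v w ^ 2)

/-- The linear map `x ↦ R_p(x, u) u` of `T_p M`. -/
def jacobi (p : M) (u : TangentSpace 𝓘(ℝ, E) p) :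
    TangentSpace 𝓘(ℝ, E) p →ₗ[ℝ] TangentSpace 𝓘(ℝ, E) p where
  toFun x := g.curvature p x u u
  map_add' x y := by
    have key (G : E → E →L[ℝ] E →L[ℝ] ℝ) (o x y u : E) : localCurvature G o (x + y) u u =
        localCurvature G o x u u + localCurvature G o y u u := by
      simp only [localCurvature, map_add, add_apply]
      abel
    exact key _ _ _ _ _
  map_smul' a x := by
    have key (G : E → E →L[ℝ] E →L[ℝ] ℝ) (o x u : E) : localCurvature G o (a • x) u u =
        a • localCurvature G o x u u := by
      simp only [localCurvature, map_smul, smul_apply, smul_sub, smul_add]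
    exact key _ _ _ _

theorem jacobi_self (p : M) (u : TangentSpace 𝓘(ℝ, E) p) : g.jacobi p u u = 0 :=
  sub_self _

/-- The orthogonal complement `u^⊥` of `u` in `T_p M`. -/
def perp (p : M) (u : TangentSpace 𝓘(ℝ, E) p) : Submodule ℝ (TangentSpace 𝓘(ℝ, E) p) :=
  LinearMap.ker (g.val p u).toLinearMap

/-- The line spanned by `u`, as a subspace of `u^⊥` (for `u` null). -/
def lineInPerp (p : M) (u : TangentSpace 𝓘(ℝ, E) p) : Submodule ℝ (g.perp p u) :=
  (Submodule.span ℝ {u}).submoduleOf (g.perp p u)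

/-- The quotient space `u^⊥ / span {u}`. -/
abbrev quotPerp (p : M) (u : TangentSpace 𝓘(ℝ, E) p) : Type _ :=
  g.perp p u ⧸ g.lineInPerp p u

instance [FiniteDimensional ℝ E] (p : M) (u : TangentSpace 𝓘(ℝ, E) p) :
    Module.Finite ℝ (g.quotPerp p u) :=
  have : FiniteDimensional ℝ (TangentSpace 𝓘(ℝ, E) p) := inferInstanceAs (FiniteDimensional ℝ E)
  inferInstance

/-- `x ↦ R_p(x, u) u` maps `u^⊥` to itself. By the symmetries of the curvature tensor this is always
so; it is what makes the Jacobi operator on `u^⊥ / span {u}` well defined. -/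
def JacobiPreservesPerp (p : M) (u : TangentSpace 𝓘(ℝ, E) p) : Prop :=
  ∀ x ∈ g.perp p u, g.jacobi p u x ∈ g.perp p u

theorem lineInPerp_le_comap (p : M) (u : TangentSpace 𝓘(ℝ, E) p)
    (h : g.JacobiPreservesPerp p u) :
    g.lineInPerp p u ≤ (g.lineInPerp p u).comap ((g.jacobi p u).restrict h) := by
  rintro ⟨x, hx⟩ hxu
  obtain ⟨a, rfl⟩ := Submodule.mem_span_singleton.1 (Submodule.mem_comap.1 hxu)
  refine Submodule.mem_comap.2 (Submodule.mem_comap.2 ?_)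
  have : g.jacobi p u (a • u) = 0 := by rw [map_smul, jacobi_self, smul_zero]
  change g.jacobi p u (a • u) ∈ _
  rw [this]
  exact zero_mem _

open Classical in
/-- The Jacobi operator `R̄_u` of a null vector `u`: the endomorphism of `u^⊥ / span {u}` that sends
the class of `x` to the class of `R_p(x, u) u`. (The `else` branch never occurs.) -/
def nullJacobi (p : M) (u : TangentSpace 𝓘(ℝ, E) p) : Module.End ℝ (g.quotPerp p u) :=
  if h : g.JacobiPreservesPerp p u then
    (g.lineInPerp p u).mapQ (g.lineInPerp p u) ((g.jacobi p u).restrict h)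
      (g.lineInPerp_le_comap p u h)
  else 0

end SemiRiemannianMetric

/-! ### Indefinite globally framed `f`-manifolds and `S`-manifolds -/

variable (E M) in
/-- An indefinite globally framed `f`-structure `(φ, ξ_α, η^α, g)` on `M`, with `s` characteristic
vector fields indexed by `Fin s`. The constancy of the rank of `φ` is implied: its kernel has
dimension `s` at every point. -/
structure IndefiniteGFF [IsManifold 𝓘(ℝ, E) ∞ M] (s : ℕ) where
  /-- the semi-Riemannian metric -/
  g : SemiRiemannianMetric E M
  /-- the `(1,1)`-tensor field -/
  φ (p : M) : TangentSpace 𝓘(ℝ, E) p →L[ℝ] TangentSpace 𝓘(ℝ, E) p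
  /-- the characteristic vector fields -/
  ξ (α : Fin s) (p : M) : TangentSpace 𝓘(ℝ, E) p
  /-- the dual 1-forms -/
  η (α : Fin s) (p : M) : TangentSpace 𝓘(ℝ, E) p →L[ℝ] ℝ
  /-- the causal signs of the characteristic vector fields -/
  ε : Fin s → ℝ
  smooth_φ : ContMDiff 𝓘(ℝ, E) (𝓘(ℝ, E).prod 𝓘(ℝ, E →L[ℝ] E)) ∞
    (fun p ↦ TotalSpace.mk' (E →L[ℝ] E)
      (E := fun p : M ↦ TangentSpace 𝓘(ℝ, E) p →L[ℝ] TangentSpace 𝓘(ℝ, E) p) p (φ p))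
  smooth_ξ (α : Fin s) (p : M) : SmoothFieldAt (ξ α) p
  smooth_η (α : Fin s) : ContMDiff 𝓘(ℝ, E) (𝓘(ℝ, E).prod 𝓘(ℝ, E →L[ℝ] ℝ)) ∞
    (fun p ↦ TotalSpace.mk' (E →L[ℝ] ℝ)
      (E := fun p : M ↦ TangentSpace 𝓘(ℝ, E) p →L[ℝ] ℝ) p (η α p))
  φ_ne_zero (p : M) : φ p ≠ 0
  ker_φ (p : M) :
    LinearMap.ker (φ p).toLinearMap = Submodule.span ℝ (Set.range fun α ↦ ξ α p)
  φ_sq (p : M) (v : TangentSpace 𝓘(ℝ, E) p) : φ p (φ p v) = -v + ∑ α, η α p v • ξ α p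
  η_ξ (p : M) (α β : Fin s) : η α p (ξ β p) = if α = β then 1 else 0
  ε_spec (p : M) (α : Fin s) :
    (ε α = 1 ∧ 0 < g.val p (ξ α p) (ξ α p)) ∨ (ε α = -1 ∧ g.val p (ξ α p) (ξ α p) < 0)
  compatible (p : M) (v w : TangentSpace 𝓘(ℝ, E) p) :
    g.val p (φ p v) (φ p w) = g.val p v w - ∑ α, ε α * η α p v * η α p w

/-- The value at `p` of the exterior derivative of a 1-form on two vector fields, with the
convention `2 dη(X, Y) = X(η Y) - Y(η X) - η([X, Y])`. -/
def extDer [IsManifold 𝓘(ℝ, E) ∞ M] (η : Π p : M, TangentSpace 𝓘(ℝ, E) p →L[ℝ] ℝ)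
    (X Y : Π p : M, TangentSpace 𝓘(ℝ, E) p) (p : M) : ℝ :=
  (1 / 2 : ℝ) * (mvfderiv 𝓘(ℝ, E) (fun q ↦ η q (Y q)) p (X p) -
    mvfderiv 𝓘(ℝ, E) (fun q ↦ η q (X q)) p (Y p) -
    η p (VectorField.mlieBracket 𝓘(ℝ, E) X Y p))

/-- The Nijenhuis torsion
`N_φ(X, Y) = φ²[X, Y] + [φX, φY] - φ[φX, Y] - φ[X, φY]` at `p`. -/
def nijenhuis [IsManifold 𝓘(ℝ, E) ∞ M]
    (φ : Π p : M, TangentSpace 𝓘(ℝ, E) p →L[ℝ] TangentSpace 𝓘(ℝ, E) p)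
    (X Y : Π p : M, TangentSpace 𝓘(ℝ, E) p) (p : M) : TangentSpace 𝓘(ℝ, E) p :=
  φ p (φ p (VectorField.mlieBracket 𝓘(ℝ, E) X Y p)) +
    VectorField.mlieBracket 𝓘(ℝ, E) (fun q ↦ φ q (X q)) (fun q ↦ φ q (Y q)) p -
    φ p (VectorField.mlieBracket 𝓘(ℝ, E) (fun q ↦ φ q (X q)) Y p) -
    φ p (VectorField.mlieBracket 𝓘(ℝ, E) X (fun q ↦ φ q (Y q)) p)

namespace IndefiniteGFF

variable [IsManifold 𝓘(ℝ, E) ∞ M] {s : ℕ} (S : IndefiniteGFF E M s)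

/-- The structure is normal: `N_φ + 2 dη^α ⊗ ξ_α = 0`. -/
def IsNormal : Prop :=
  ∀ (p : M) (X Y : Π p : M, TangentSpace 𝓘(ℝ, E) p), SmoothFieldAt X p → SmoothFieldAt Y p →
    nijenhuis S.φ X Y p + ∑ α, (2 * extDer (S.η α) X Y p) • S.ξ α p = 0

/-- An indefinite `S`-structure: it is normal and `dη^α = Φ` for all `α`, where
`Φ(X, Y) = g(X, φ Y)`. -/
def IsSManifold : Prop :=
  S.IsNormal ∧
  ∀ (α : Fin s) (p : M) (X Y : Π p : M, TangentSpace 𝓘(ℝ, E) p),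
    SmoothFieldAt X p → SmoothFieldAt Y p →
      extDer (S.η α) X Y p = S.g.val p (X p) (S.φ p (Y p))

/-- The `φ`-sectional curvature is constantly `c`: for every point `p` and every non-lightlike
`X` in the image of `φ_p`, the plane spanned by `X` and `φ X` has sectional curvature `c`. -/
def HasConstantPhiSectionalCurvature (c : ℝ) : Prop :=
  ∀ (p : M) (X : TangentSpace 𝓘(ℝ, E) p), X ∈ Set.range (S.φ p) → S.g.val p X X ≠ 0 →
    S.g.sectionalCurvature p X (S.φ p X) = c

/-- The `φ`-celestial sphere of `(ξ_α)_p`. -/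
def phiCelestialSphere (α : Fin s) (p : M) : Set (TangentSpace 𝓘(ℝ, E) p) :=
  {x | S.g.val p x (S.ξ α p) = 0 ∧ S.g.val p x x = 1} ∩ Set.range (S.φ p)

/-- The `φ`-null congruence set of `(ξ_α)_p`. -/
def phiNullCongruence (α : Fin s) (p : M) : Set (TangentSpace 𝓘(ℝ, E) p) :=
  {u | ∃ x ∈ S.phiCelestialSphere α p, u = S.ξ α p + x}

/-- The `φ`-null Osserman condition with respect to `(ξ_α)_p` at `p`. -/
def IsPhiNullOssermanAt [FiniteDimensional ℝ E] (α : Fin s) (p : M) : Prop :=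
  ∀ u ∈ S.phiNullCongruence α p, ∀ v ∈ S.phiNullCongruence α p,
    (S.g.nullJacobi p u).charpoly = (S.g.nullJacobi p v).charpoly

/-- The global `φ`-null Osserman condition with respect to `ξ_α`: it holds at every point, and the
characteristic polynomial does not depend on the point either. -/
def IsGloballyPhiNullOsserman [FiniteDimensional ℝ E] (α : Fin s) : Prop :=
  (∀ p : M, S.IsPhiNullOssermanAt α p) ∧
  ∀ p q : M, ∀ u ∈ S.phiNullCongruence α p, ∀ v ∈ S.phiNullCongruence α q,
    (S.g.nullJacobi p u).charpoly = (S.g.nullJacobi q v).charpoly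

end IndefiniteGFF

end PhiNull

end

/-! Write ξ̄ = Σ ξ_α and η̄ = Σ ε_α η^α. The structure equations of an S-manifold determine the
covariant derivatives of its tensors: ∇_v ξ_α = -ε_α φv (`FFrame.nabla_ξ`) and (∇_v φ)w = g(φv, φw)
ξ̄ + η̄(w) φ²v (`FFrame.nabla_φ`). Both are proved by linear algebra in one tangent space, from
identities obtained by differentiating the structure equations in a chart.

Differentiating the two formulas once more gives R(v, w)ξ_α (`localCurvature_ξ`) and the commutator
of R(v, w) with φ on Im φ (`localCurvature_φ`). With e = Σ ε_α, subtracting from R the constant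
curvature tensor of curvature e and (c - e)/4 times the complex space form tensor leaves, on Im φ, a
Kähler-like tensor with zero holomorphic sectional curvature. Polarization makes its Jacobi
operators vanish (`kaehler_curvature_eq_zero`), so that R(·, x)x is explicit on Im φ.

For u = ξ_0 + x (index 0 stands for the timelike field) the quotient u^⊥/⟨u⟩ is the direct sum of
the line of φx, the part of Im φ orthogonal to x and φx, and the span of the spacelike ξ_β. Since e
= s - 2, the Jacobi operator is c + 1 on the first and 1 + e + (c - e)/4 = (c + 3s - 2)/4 on the
second. On the third it sends each ξ_β to Σ ξ_γ modulo u, which is the all-ones matrix of size s - 1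
(`charpoly_jacobi`). None of this depends on u or on the point. -/

noncomputable section

namespace PhiNull

open VectorField Filter
open scoped Topology

/-! ### Vector fields, brackets and derivatives in the preferred chart -/

section Chart

variable {E : Type*} [NormedAddCommGroup E] [NormedSpace ℝ E]
  {M : Type*} [TopologicalSpace M] [ChartedSpace E M]

variable [IsManifold 𝓘(ℝ, E) ∞ M]

/-- The differential at `y` of the inverse of the preferred chart at `p`. -/
def chartFrame (p : M) (y : E) : E →L[ℝ] TangentSpace 𝓘(ℝ, E) ((extChartAt 𝓘(ℝ, E) p).symm y) :=
  mfderiv 𝓘(ℝ, E) 𝓘(ℝ, E) (extChartAt 𝓘(ℝ, E) p).symm y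

/-- The differential at `chart⁻¹ y` of the preferred chart at `p`. -/
def chartCoframe (p : M) (y : E) :
    TangentSpace 𝓘(ℝ, E) ((extChartAt 𝓘(ℝ, E) p).symm y) →L[ℝ] E :=
  mfderiv 𝓘(ℝ, E) 𝓘(ℝ, E) (extChartAt 𝓘(ℝ, E) p) ((extChartAt 𝓘(ℝ, E) p).symm y)

theorem chartCoframe_comp_chartFrame (p : M) {y : E} (hy : y ∈ (extChartAt 𝓘(ℝ, E) p).target) :
    chartCoframe p y ∘L chartFrame p y = ContinuousLinearMap.id ℝ E := by
  have : IsManifold 𝓘(ℝ, E) 1 M := .of_le (n := ∞) (by simp)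
  have := mfderiv_extChartAt_comp_mfderivWithin_extChartAt_symm hy
  rw [modelWithCornersSelf_coe, Set.range_id, mfderivWithin_univ] at this
  exact this

theorem chartFrame_comp_chartCoframe (p : M) {y : E} (hy : y ∈ (extChartAt 𝓘(ℝ, E) p).target) :
    chartFrame p y ∘L chartCoframe p y = ContinuousLinearMap.id ℝ _ := by
  have : IsManifold 𝓘(ℝ, E) 1 M := .of_le (n := ∞) (by simp)
  have := mfderivWithin_extChartAt_symm_comp_mfderiv_extChartAt hy
  rw [modelWithCornersSelf_coe, Set.range_id, mfderivWithin_univ] at this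
  exact this

theorem chartCoframe_chartFrame (p : M) {y : E} (hy : y ∈ (extChartAt 𝓘(ℝ, E) p).target) (v : E) :
    chartCoframe p y (chartFrame p y v) = v :=
  DFunLike.congr_fun (chartCoframe_comp_chartFrame p hy) v

theorem chartFrame_chartCoframe (p : M) {y : E} (hy : y ∈ (extChartAt 𝓘(ℝ, E) p).target)
    (v : TangentSpace 𝓘(ℝ, E) ((extChartAt 𝓘(ℝ, E) p).symm y)) :
    chartFrame p y (chartCoframe p y v) = v :=
  DFunLike.congr_fun (chartFrame_comp_chartCoframe p hy) v

theorem inverse_chartFrame (p : M) {y : E} (hy : y ∈ (extChartAt 𝓘(ℝ, E) p).target) :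
    (chartFrame p y).inverse = chartCoframe p y :=
  ContinuousLinearMap.inverse_eq (chartFrame_comp_chartCoframe p hy)
    (chartCoframe_comp_chartFrame p hy)

theorem inverse_chartCoframe (p : M) {y : E} (hy : y ∈ (extChartAt 𝓘(ℝ, E) p).target) :
    (chartCoframe p y).inverse = chartFrame p y :=
  ContinuousLinearMap.inverse_eq (chartCoframe_comp_chartFrame p hy)
    (chartFrame_comp_chartCoframe p hy)

/-- The vector field on the domain of the preferred chart at `p` with components `V`. -/
def chartField (p : M) (V : E → E) : Π q : M, TangentSpace 𝓘(ℝ, E) q :=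
  mpullback 𝓘(ℝ, E) 𝓘(ℝ, E) (extChartAt 𝓘(ℝ, E) p) V

theorem chartField_symm (p : M) (V : E → E) {y : E} (hy : y ∈ (extChartAt 𝓘(ℝ, E) p).target) :
    chartField p V ((extChartAt 𝓘(ℝ, E) p).symm y) = chartFrame p y (V y) := by
  change (chartCoframe p y).inverse (V (extChartAt 𝓘(ℝ, E) p ((extChartAt 𝓘(ℝ, E) p).symm y))) = _
  rw [inverse_chartCoframe p hy, (extChartAt 𝓘(ℝ, E) p).right_inv hy]

/-- The components of a vector field in the preferred chart at `p`. -/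
def chartComponents (p : M) (X : Π q : M, TangentSpace 𝓘(ℝ, E) q) (y : E) : E :=
  chartCoframe p y (X ((extChartAt 𝓘(ℝ, E) p).symm y))

theorem smoothFieldAt_chartField [CompleteSpace E] (p : M) {V : E → E} {q : M}
    (hq : q ∈ (extChartAt 𝓘(ℝ, E) p).source)
    (hV : ContDiffAt ℝ ∞ V (extChartAt 𝓘(ℝ, E) p q)) : SmoothFieldAt (chartField p V) q := by
  have : IsManifold 𝓘(ℝ, E) 1 M := .of_le (n := ∞) (by simp)
  have hq' : q ∈ (chartAt E p).source := by simpa using hq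
  exact ContMDiffAt.mpullback_vectorField_preimage (n := ∞)
    (contMDiffAt_vectorSpace_iff_contDiffAt.2 hV) (contMDiffAt_extChartAt' hq')
    (isInvertible_mfderiv_extChartAt hq) (by simp)

theorem contMDiffAt_chart_symm (p : M) {y : E} (hy : y ∈ (extChartAt 𝓘(ℝ, E) p).target) :
    ContMDiffAt 𝓘(ℝ, E) 𝓘(ℝ, E) ∞ (extChartAt 𝓘(ℝ, E) p).symm y :=
  (contMDiffOn_extChartAt_symm p).contMDiffAt ((isOpen_extChartAt_target p).mem_nhds hy)

theorem contDiffAt_chartComponents [CompleteSpace E] (p : M) {X : Π q : M, TangentSpace 𝓘(ℝ, E) q}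
    {y : E} (hy : y ∈ (extChartAt 𝓘(ℝ, E) p).target)
    (hX : SmoothFieldAt X ((extChartAt 𝓘(ℝ, E) p).symm y)) :
    ContDiffAt ℝ ∞ (chartComponents p X) y := by
  have : IsManifold 𝓘(ℝ, E) 1 M := .of_le (n := ∞) (by simp)
  have hinv := isInvertible_mfderivWithin_extChartAt_symm hy
  rw [modelWithCornersSelf_coe, Set.range_id, mfderivWithin_univ] at hinv
  have h := ContMDiffAt.mpullback_vectorField_preimage (n := ∞) hX (contMDiffAt_chart_symm p hy)
    hinv (by simp)
  refine (contMDiffAt_vectorSpace_iff_contDiffAt.1 h).congr_of_eventuallyEq ?_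
  filter_upwards [(isOpen_extChartAt_target p).mem_nhds hy] with z hz
  change _ = (chartFrame p z).inverse _
  rw [inverse_chartFrame p hz]
  rfl

/-- Pull-back by the chart commutes with brackets, and on a vector space the bracket is the usual
DW·V - DV·W. -/
theorem mlieBracket_chartField [CompleteSpace E] (p : M) {V W : E → E} {y : E}
    (hy : y ∈ (extChartAt 𝓘(ℝ, E) p).target)
    (hV : ContDiffAt ℝ 1 V y) (hW : ContDiffAt ℝ 1 W y) :
    mlieBracket 𝓘(ℝ, E) (chartField p V) (chartField p W) ((extChartAt 𝓘(ℝ, E) p).symm y) =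
      chartFrame p y (fderiv ℝ W y (V y) - fderiv ℝ V y (W y)) := by
  have : IsManifold 𝓘(ℝ, E) (minSmoothness ℝ 2) M :=
    .of_le (n := ∞) (by rw [minSmoothness_of_isRCLikeNormedField]; exact ENat.LEInfty.out)
  set q := (extChartAt 𝓘(ℝ, E) p).symm y with hq
  have hqs : q ∈ (chartAt E p).source := by
    rw [← extChartAt_source 𝓘(ℝ, E)]
    exact (extChartAt 𝓘(ℝ, E) p).map_target hy
  have hqy : extChartAt 𝓘(ℝ, E) p q = y := (extChartAt 𝓘(ℝ, E) p).right_inv hy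
  have h := mpullback_mlieBracket (I := 𝓘(ℝ, E)) (I' := 𝓘(ℝ, E)) (n := ∞) (V := V) (W := W)
    (f := extChartAt 𝓘(ℝ, E) p) (x₀ := q)
    ((contMDiffAt_vectorSpace_iff_contDiffAt.2 (by rwa [hqy])).mdifferentiableAt one_ne_zero)
    ((contMDiffAt_vectorSpace_iff_contDiffAt.2 (by rwa [hqy])).mdifferentiableAt one_ne_zero)
    (contMDiffAt_extChartAt' hqs)
    (by rw [minSmoothness_of_isRCLikeNormedField]; exact ENat.LEInfty.out)
  have h' : (mlieBracket 𝓘(ℝ, E) V W : E → E) = lieBracket ℝ V W := by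
    rw [← lieBracketWithin_univ]
    exact mlieBracketWithin_eq_lieBracketWithin
  refine h.symm.trans ((chartField_symm p _ hy).trans ?_)
  rw [h']
  rfl

theorem mvfderiv_chart [CompleteSpace E] (p : M) {f : M → ℝ} {F : E → ℝ} {y : E}
    (hy : y ∈ (extChartAt 𝓘(ℝ, E) p).target) (hF : DifferentiableAt ℝ F y)
    (hfF : ∀ z ∈ (extChartAt 𝓘(ℝ, E) p).target, f ((extChartAt 𝓘(ℝ, E) p).symm z) = F z) (v : E) :
    mvfderiv 𝓘(ℝ, E) f ((extChartAt 𝓘(ℝ, E) p).symm y) (chartFrame p y v) = fderiv ℝ F y v := by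
  have : IsManifold 𝓘(ℝ, E) 1 M := .of_le (n := ∞) (by simp)
  set q := (extChartAt 𝓘(ℝ, E) p).symm y with hq
  have hqs : q ∈ (extChartAt 𝓘(ℝ, E) p).source := (extChartAt 𝓘(ℝ, E) p).map_target hy
  have hqy : extChartAt 𝓘(ℝ, E) p q = y := (extChartAt 𝓘(ℝ, E) p).right_inv hy
  have hf : f =ᶠ[𝓝 q] F ∘ extChartAt 𝓘(ℝ, E) p := by
    filter_upwards [(isOpen_extChartAt_source p).mem_nhds hqs] with z hz
    rw [Function.comp_apply, ← hfF _ ((extChartAt 𝓘(ℝ, E) p).map_source hz),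
      (extChartAt 𝓘(ℝ, E) p).left_inv hz]
  have hd : mfderiv 𝓘(ℝ, E) 𝓘(ℝ, ℝ) f q =
      mfderiv 𝓘(ℝ, E) 𝓘(ℝ, ℝ) F (extChartAt 𝓘(ℝ, E) p q) ∘L
        mfderiv 𝓘(ℝ, E) 𝓘(ℝ, E) (extChartAt 𝓘(ℝ, E) p) q := by
    rw [hf.mfderiv_eq, mfderiv_comp q (I' := 𝓘(ℝ, E))]
    · exact DifferentiableAt.mdifferentiableAt (by rwa [hqy])
    · exact mdifferentiableAt_extChartAt (by simpa using hqs)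
  change (mfderiv 𝓘(ℝ, E) 𝓘(ℝ, ℝ) f q : TangentSpace 𝓘(ℝ, E) q →L[ℝ] ℝ) (chartFrame p y v) = _
  rw [hd, hqy, mfderiv_eq_fderiv]
  change fderiv ℝ F y (chartCoframe p y (chartFrame p y v)) = _
  rw [chartCoframe_chartFrame p hy]

end Chart

/-- An indefinite `S`-structure on an open subset `U` of a vector space, in terms of the components
of its tensor fields. -/
structure LocalSStructure {E : Type*} [NormedAddCommGroup E] [NormedSpace ℝ E] {s : ℕ} (U : Set E)
    (ε : Fin s → ℝ) (G : E → E →L[ℝ] E →L[ℝ] ℝ) (φ : E → E →L[ℝ] E) (ξ : Fin s → E → E)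
    (η : Fin s → E → E →L[ℝ] ℝ) : Prop where
  isOpen : IsOpen U
  contDiff_G : ContDiffOn ℝ ∞ G U
  contDiff_φ : ContDiffOn ℝ ∞ φ U
  contDiff_ξ (α : Fin s) : ContDiffOn ℝ ∞ (ξ α) U
  contDiff_η (α : Fin s) : ContDiffOn ℝ ∞ (η α) U
  ε_sq (α : Fin s) : ε α * ε α = 1
  symm {y : E} (hy : y ∈ U) (v w : E) : G y v w = G y w v
  nondegenerate {y : E} (hy : y ∈ U) (v : E) (hv : ∀ w, G y v w = 0) : v = 0
  φ_sq {y : E} (hy : y ∈ U) (v : E) : φ y (φ y v) = -v + ∑ α, η α y v • ξ α y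
  φ_ξ {y : E} (hy : y ∈ U) (α : Fin s) : φ y (ξ α y) = 0
  η_ξ {y : E} (hy : y ∈ U) (α β : Fin s) : η α y (ξ β y) = if α = β then 1 else 0
  compatible {y : E} (hy : y ∈ U) (v w : E) :
    G y (φ y v) (φ y w) = G y v w - ∑ α, ε α * η α y v * η α y w
  extDer_η {y : E} (hy : y ∈ U) (α : Fin s) (v w : E) :
    fderiv ℝ (η α) y v w - fderiv ℝ (η α) y w v = 2 * G y v (φ y w)
  normal {y : E} (hy : y ∈ U) (v w : E) :
    fderiv ℝ φ y (φ y v) w - fderiv ℝ φ y (φ y w) v + φ y (fderiv ℝ φ y w v) -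
      φ y (fderiv ℝ φ y v w) + (2 * G y v (φ y w)) • ∑ α, ξ α y = 0

/-! ### Transfer of the S-structure to a chart -/

section Chart

variable {E : Type*} [NormedAddCommGroup E] [NormedSpace ℝ E]
  {M : Type*} [TopologicalSpace M] [ChartedSpace E M] [IsManifold 𝓘(ℝ, E) ∞ M]

theorem SemiRiemannianMetric.chartCoeff_apply (g : SemiRiemannianMetric E M) (p : M) (y v w : E) :
    g.chartCoeff p y v w = g.val ((extChartAt 𝓘(ℝ, E) p).symm y)
      (chartFrame p y v) (chartFrame p y w) :=
  rfl

theorem contMDiffAt_oneForm_apply {η : Π p : M, TangentSpace 𝓘(ℝ, E) p →L[ℝ] ℝ}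
    {X : Π p : M, TangentSpace 𝓘(ℝ, E) p} {q : M}
    (hη : ContMDiffAt 𝓘(ℝ, E) (𝓘(ℝ, E).prod 𝓘(ℝ, E →L[ℝ] ℝ)) ∞
      (fun p ↦ TotalSpace.mk' (E →L[ℝ] ℝ)
        (E := fun p : M ↦ TangentSpace 𝓘(ℝ, E) p →L[ℝ] ℝ) p (η p)) q)
    (hX : SmoothFieldAt X q) : ContMDiffAt 𝓘(ℝ, E) 𝓘(ℝ, ℝ) ∞ (fun q ↦ η q (X q)) q := by
  have : ContMDiffAt 𝓘(ℝ, E) (𝓘(ℝ, E).prod 𝓘(ℝ, ℝ)) ∞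
      (fun m ↦ TotalSpace.mk' ℝ (E := Bundle.Trivial M ℝ) m (η m (X m))) q :=
    ContMDiffAt.clm_bundle_apply (F₁ := E) (F₂ := ℝ) hη hX
  simp only [contMDiffAt_totalSpace] at this
  exact this.2

theorem SemiRiemannianMetric.contMDiffAt_apply (g : SemiRiemannianMetric E M)
    {X Y : Π p : M, TangentSpace 𝓘(ℝ, E) p} {q : M} (hX : SmoothFieldAt X q)
    (hY : SmoothFieldAt Y q) :
    ContMDiffAt 𝓘(ℝ, E) 𝓘(ℝ, ℝ) ∞ (fun q ↦ g.val q (X q) (Y q)) q := by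
  have : ContMDiffAt 𝓘(ℝ, E) (𝓘(ℝ, E).prod 𝓘(ℝ, ℝ)) ∞
      (fun m ↦ TotalSpace.mk' ℝ (E := Bundle.Trivial M ℝ) m (g.val m (X m) (Y m))) q :=
    ContMDiffAt.clm_bundle_apply₂ (F₁ := E) (F₂ := E) (F₃ := ℝ) (g.smooth q) hX hY
  simp only [contMDiffAt_totalSpace] at this
  exact this.2

theorem smoothFieldAt_apply {φ : Π p : M, TangentSpace 𝓘(ℝ, E) p →L[ℝ] TangentSpace 𝓘(ℝ, E) p}
    {X : Π p : M, TangentSpace 𝓘(ℝ, E) p} {q : M}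
    (hφ : ContMDiffAt 𝓘(ℝ, E) (𝓘(ℝ, E).prod 𝓘(ℝ, E →L[ℝ] E)) ∞
      (fun p ↦ TotalSpace.mk' (E →L[ℝ] E)
        (E := fun p : M ↦ TangentSpace 𝓘(ℝ, E) p →L[ℝ] TangentSpace 𝓘(ℝ, E) p) p (φ p)) q)
    (hX : SmoothFieldAt X q) : SmoothFieldAt (fun q ↦ φ q (X q)) q :=
  ContMDiffAt.clm_bundle_apply (F₁ := E) (F₂ := E) hφ hX

theorem contDiffAt_of_chart (p : M) {f : M → ℝ} {F : E → ℝ} {y : E}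
    (hy : y ∈ (extChartAt 𝓘(ℝ, E) p).target)
    (hf : ContMDiffAt 𝓘(ℝ, E) 𝓘(ℝ, ℝ) ∞ f ((extChartAt 𝓘(ℝ, E) p).symm y))
    (hfF : ∀ z ∈ (extChartAt 𝓘(ℝ, E) p).target, f ((extChartAt 𝓘(ℝ, E) p).symm z) = F z) :
    ContDiffAt ℝ ∞ F y := by
  have h : ContMDiffAt 𝓘(ℝ, E) 𝓘(ℝ, ℝ) ∞ (f ∘ (extChartAt 𝓘(ℝ, E) p).symm) y :=
    hf.comp y (contMDiffAt_chart_symm p hy)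
  refine h.contDiffAt.congr_of_eventuallyEq ?_
  filter_upwards [(isOpen_extChartAt_target p).mem_nhds hy] with z hz
  exact (hfF z hz).symm

theorem smoothFieldAt_chartField_symm [CompleteSpace E] (p : M) {V : E → E} {y : E}
    (hy : y ∈ (extChartAt 𝓘(ℝ, E) p).target) (hV : ContDiffAt ℝ ∞ V y) :
    SmoothFieldAt (chartField p V) ((extChartAt 𝓘(ℝ, E) p).symm y) :=
  smoothFieldAt_chartField p ((extChartAt 𝓘(ℝ, E) p).map_target hy)
    (by rwa [(extChartAt 𝓘(ℝ, E) p).right_inv hy])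

/-- In finite dimension an operator-valued map is smooth as soon as its values on fixed vectors are.
A fixed vector is the component of a smooth field, on which smoothness as a bundle section can be
used. -/
theorem SemiRiemannianMetric.contDiffOn_chartCoeff [FiniteDimensional ℝ E]
    (g : SemiRiemannianMetric E M) (p : M) :
    ContDiffOn ℝ ∞ (g.chartCoeff p) (extChartAt 𝓘(ℝ, E) p).target := by
  have : CompleteSpace E := FiniteDimensional.complete ℝ E
  refine contDiffOn_clm_apply.2 fun v ↦ contDiffOn_clm_apply.2 fun w y hy ↦ ?_
  refine (contDiffAt_of_chart p hy (g.contMDiffAt_apply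
    (smoothFieldAt_chartField_symm p hy (contDiffAt_const (c := v)))
    (smoothFieldAt_chartField_symm p hy (contDiffAt_const (c := w))))
    fun z hz ↦ ?_).contDiffWithinAt
  rw [chartField_symm p _ hz, chartField_symm p _ hz, chartCoeff_apply]

namespace IndefiniteGFF

variable {s : ℕ} (S : IndefiniteGFF E M s)

/-- The components of `φ` in the preferred chart at `p`. -/
def chartφ (p : M) (y : E) : E →L[ℝ] E :=
  chartCoframe p y ∘L S.φ ((extChartAt 𝓘(ℝ, E) p).symm y) ∘L chartFrame p y

/-- The components of `η α` in the preferred chart at `p`. -/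
def chartη (p : M) (α : Fin s) (y : E) : E →L[ℝ] ℝ :=
  S.η α ((extChartAt 𝓘(ℝ, E) p).symm y) ∘L chartFrame p y

/-- The components of `ξ α` in the preferred chart at `p`. -/
def chartξ (p : M) (α : Fin s) : E → E :=
  chartComponents p (S.ξ α)

theorem chartφ_apply (p : M) (y v : E) : S.chartφ p y v =
    chartCoframe p y (S.φ ((extChartAt 𝓘(ℝ, E) p).symm y) (chartFrame p y v)) :=
  rfl

theorem chartη_apply (p : M) (α : Fin s) (y v : E) : S.chartη p α y v =
    S.η α ((extChartAt 𝓘(ℝ, E) p).symm y) (chartFrame p y v) :=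
  rfl

theorem chartξ_apply (p : M) (α : Fin s) (y : E) : S.chartξ p α y =
    chartCoframe p y (S.ξ α ((extChartAt 𝓘(ℝ, E) p).symm y)) :=
  rfl

theorem chartFrame_chartφ (p : M) {y : E} (hy : y ∈ (extChartAt 𝓘(ℝ, E) p).target) (v : E) :
    chartFrame p y (S.chartφ p y v) =
      S.φ ((extChartAt 𝓘(ℝ, E) p).symm y) (chartFrame p y v) := by
  rw [chartφ_apply, chartFrame_chartCoframe p hy]

theorem chartFrame_chartξ (p : M) (α : Fin s) {y : E} (hy : y ∈ (extChartAt 𝓘(ℝ, E) p).target) :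
    chartFrame p y (S.chartξ p α y) = S.ξ α ((extChartAt 𝓘(ℝ, E) p).symm y) := by
  rw [chartξ_apply, chartFrame_chartCoframe p hy]

theorem φ_ξ (p : M) (α : Fin s) : S.φ p (S.ξ α p) = 0 := by
  have h : S.ξ α p ∈ LinearMap.ker (S.φ p).toLinearMap := by
    rw [S.ker_φ p]
    exact Submodule.subset_span ⟨α, rfl⟩
  exact h

theorem ε_mul_self [Nonempty M] (α : Fin s) : S.ε α * S.ε α = 1 := by
  obtain ⟨p⟩ := ‹Nonempty M›
  rcases S.ε_spec p α with h | h <;> rw [h.1] <;> norm_num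

/-- Applying `φ` to a vector field corresponds to applying the components of `φ`. -/
theorem φ_chartField_eventuallyEq (p : M) (V : E → E) {y : E}
    (hy : y ∈ (extChartAt 𝓘(ℝ, E) p).target) :
    (fun q ↦ S.φ q (chartField p V q)) =ᶠ[𝓝 ((extChartAt 𝓘(ℝ, E) p).symm y)]
      chartField p (fun z ↦ S.chartφ p z (V z)) := by
  filter_upwards [(isOpen_extChartAt_source p).mem_nhds
    ((extChartAt 𝓘(ℝ, E) p).map_target hy)] with q hq
  obtain ⟨z, hz, rfl⟩ : ∃ z ∈ (extChartAt 𝓘(ℝ, E) p).target,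
      (extChartAt 𝓘(ℝ, E) p).symm z = q :=
    ⟨_, (extChartAt 𝓘(ℝ, E) p).map_source hq, (extChartAt 𝓘(ℝ, E) p).left_inv hq⟩
  rw [chartField_symm p _ hz, chartField_symm p _ hz, chartFrame_chartφ S p hz]

variable [FiniteDimensional ℝ E]

theorem contDiffOn_chartφ (p : M) :
    ContDiffOn ℝ ∞ (S.chartφ p) (extChartAt 𝓘(ℝ, E) p).target := by
  have : CompleteSpace E := FiniteDimensional.complete ℝ E
  refine contDiffOn_clm_apply.2 fun v y hy ↦ ?_
  refine ((contDiffAt_chartComponents p hy (smoothFieldAt_apply (S.smooth_φ _)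
    (smoothFieldAt_chartField_symm p hy (contDiffAt_const (c := v))))).congr_of_eventuallyEq
    ?_).contDiffWithinAt
  filter_upwards [(isOpen_extChartAt_target p).mem_nhds hy] with z hz
  rw [chartComponents, chartField_symm p _ hz, chartφ_apply]

theorem contDiffOn_chartη (p : M) (α : Fin s) :
    ContDiffOn ℝ ∞ (S.chartη p α) (extChartAt 𝓘(ℝ, E) p).target := by
  have : CompleteSpace E := FiniteDimensional.complete ℝ E
  refine contDiffOn_clm_apply.2 fun v y hy ↦ ?_
  refine (contDiffAt_of_chart p hy (contMDiffAt_oneForm_apply (S.smooth_η α _)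
    (smoothFieldAt_chartField_symm p hy (contDiffAt_const (c := v))))
    fun z hz ↦ ?_).contDiffWithinAt
  rw [chartField_symm p _ hz, chartη_apply]

theorem contDiffOn_chartξ (p : M) (α : Fin s) :
    ContDiffOn ℝ ∞ (S.chartξ p α) (extChartAt 𝓘(ℝ, E) p).target := by
  have : CompleteSpace E := FiniteDimensional.complete ℝ E
  exact fun y hy ↦ (contDiffAt_chartComponents p hy (S.smooth_ξ α _)).contDiffWithinAt

theorem extDer_chartField (p : M) (α : Fin s) {y : E} (hy : y ∈ (extChartAt 𝓘(ℝ, E) p).target)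
    (v w : E) :
    extDer (S.η α) (chartField p fun _ ↦ v) (chartField p fun _ ↦ w)
        ((extChartAt 𝓘(ℝ, E) p).symm y) =
      (1 / 2 : ℝ) * (fderiv ℝ (S.chartη p α) y v w - fderiv ℝ (S.chartη p α) y w v) := by
  have : CompleteSpace E := FiniteDimensional.complete ℝ E
  have hd : DifferentiableAt ℝ (S.chartη p α) y :=
    ((S.contDiffOn_chartη p α).contDiffAt
      ((isOpen_extChartAt_target p).mem_nhds hy)).differentiableAt (by simp)
  have key (a b : E) : mvfderiv 𝓘(ℝ, E) (fun q ↦ S.η α q (chartField p (fun _ ↦ a) q))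
      ((extChartAt 𝓘(ℝ, E) p).symm y) (chartFrame p y b) = fderiv ℝ (S.chartη p α) y b a := by
    rw [mvfderiv_chart p (F := fun z ↦ S.chartη p α z a) hy (hd.clm_apply (by fun_prop)),
      fderiv_clm_apply hd (by fun_prop)]
    · simp
    · intro z hz
      rw [chartField_symm p _ hz, chartη_apply]
  rw [extDer, mlieBracket_chartField p hy contDiffAt_const contDiffAt_const,
    chartField_symm p _ hy, chartField_symm p _ hy, key, key]
  simp only [fderiv_fun_const, Pi.zero_apply, zero_apply, sub_self, map_zero, sub_zero]

/-- Fields with constant components commute, so the φ² term drops out and the other brackets only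
differentiate the coefficients of φ. -/
theorem nijenhuis_chartField (p : M) {y : E} (hy : y ∈ (extChartAt 𝓘(ℝ, E) p).target) (v w : E) :
    nijenhuis S.φ (chartField p fun _ ↦ v) (chartField p fun _ ↦ w)
        ((extChartAt 𝓘(ℝ, E) p).symm y) =
      chartFrame p y (fderiv ℝ (S.chartφ p) y (S.chartφ p y v) w -
        fderiv ℝ (S.chartφ p) y (S.chartφ p y w) v +
        S.chartφ p y (fderiv ℝ (S.chartφ p) y w v) -
        S.chartφ p y (fderiv ℝ (S.chartφ p) y v w)) := by
  have : CompleteSpace E := FiniteDimensional.complete ℝ E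
  have hc : ContDiffAt ℝ ∞ (S.chartφ p) y :=
    (S.contDiffOn_chartφ p).contDiffAt ((isOpen_extChartAt_target p).mem_nhds hy)
  have hd : DifferentiableAt ℝ (S.chartφ p) y := hc.differentiableAt (by simp)
  have hc' (a : E) : ContDiffAt ℝ 1 (fun z ↦ S.chartφ p z a) y :=
    (hc.of_le (by simp)).clm_apply contDiffAt_const
  have hf (a b : E) : fderiv ℝ (fun z ↦ S.chartφ p z a) y b = fderiv ℝ (S.chartφ p) y b a := by
    rw [fderiv_clm_apply hd (by fun_prop)]
    simp
  rw [nijenhuis,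
    (S.φ_chartField_eventuallyEq p _ hy).mlieBracket_vectorField_eq
      (S.φ_chartField_eventuallyEq p _ hy),
    (S.φ_chartField_eventuallyEq p _ hy).mlieBracket_vectorField_eq
      (EventuallyEq.refl _ (chartField p fun _ ↦ w)),
    (EventuallyEq.refl _ (chartField p fun _ ↦ v)).mlieBracket_vectorField_eq
      (S.φ_chartField_eventuallyEq p _ hy),
    mlieBracket_chartField p hy contDiffAt_const contDiffAt_const,
    mlieBracket_chartField p hy (hc' v) (hc' w),
    mlieBracket_chartField p hy (hc' v) contDiffAt_const,
    mlieBracket_chartField p hy contDiffAt_const (hc' w)]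
  simp only [hf, ← S.chartFrame_chartφ p hy, ← map_add, ← map_sub]
  congr 1
  simp

/-- Every axiom is tensorial, so it is enough to evaluate it on fields with constant components;
injectivity of the chart differential brings the vector identities back to `E`. -/
theorem localSStructure [Nonempty M] (hS : S.IsSManifold) (p : M) :
    LocalSStructure (extChartAt 𝓘(ℝ, E) p).target S.ε (S.g.chartCoeff p) (S.chartφ p) (S.chartξ p)
      (S.chartη p) := by
  have : CompleteSpace E := FiniteDimensional.complete ℝ E
  have hinj {y : E} (hy : y ∈ (extChartAt 𝓘(ℝ, E) p).target) {a b : E}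
      (h : chartFrame p y a = chartFrame p y b) : a = b := by
    rw [← chartCoframe_chartFrame p hy a, h, chartCoframe_chartFrame p hy]
  have hsm {y : E} (hy : y ∈ (extChartAt 𝓘(ℝ, E) p).target) (v : E) :
      SmoothFieldAt (chartField p fun _ ↦ v) ((extChartAt 𝓘(ℝ, E) p).symm y) :=
    smoothFieldAt_chartField_symm p hy contDiffAt_const
  have hΦ {y : E} (hy : y ∈ (extChartAt 𝓘(ℝ, E) p).target) (α : Fin s) (v w : E) :
      extDer (S.η α) (chartField p fun _ ↦ v) (chartField p fun _ ↦ w)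
        ((extChartAt 𝓘(ℝ, E) p).symm y) = S.g.chartCoeff p y v (S.chartφ p y w) := by
    rw [hS.2 α _ _ _ (hsm hy v) (hsm hy w), chartField_symm p _ hy, chartField_symm p _ hy,
      SemiRiemannianMetric.chartCoeff_apply, S.chartFrame_chartφ p hy]
  refine
    { isOpen := isOpen_extChartAt_target p
      contDiff_G := S.g.contDiffOn_chartCoeff p
      contDiff_φ := S.contDiffOn_chartφ p
      contDiff_ξ := S.contDiffOn_chartξ p
      contDiff_η := S.contDiffOn_chartη p
      ε_sq := S.ε_mul_self
      symm := fun _ v w ↦ S.g.symm _ _ _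
      nondegenerate := fun {y} hy v hv ↦ hinj hy ?_
      φ_sq := fun hy v ↦ hinj hy ?_
      φ_ξ := fun hy α ↦ hinj hy ?_
      η_ξ := fun hy α β ↦ ?_
      compatible := fun hy v w ↦ ?_
      extDer_η := fun hy α v w ↦ ?_
      normal := fun hy v w ↦ hinj hy ?_ }
  · rw [map_zero]
    refine S.g.nondegenerate _ _ fun w ↦ ?_
    rw [← chartFrame_chartCoframe p hy w]
    exact hv _
  · simp only [S.chartFrame_chartφ p hy, S.φ_sq, map_add, map_neg, map_sum, map_smul,
      S.chartFrame_chartξ p _ hy, chartη_apply]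
  · rw [S.chartFrame_chartφ p hy, S.chartFrame_chartξ p _ hy, S.φ_ξ, map_zero]
  · rw [chartη_apply, S.chartFrame_chartξ p _ hy, S.η_ξ]
  · simp only [SemiRiemannianMetric.chartCoeff_apply, S.chartFrame_chartφ p hy, S.compatible,
      chartη_apply]
  · rw [← hΦ hy α, S.extDer_chartField p α hy]
    ring
  · have h := hS.1 _ _ _ (hsm hy v) (hsm hy w)
    simp only [hΦ hy, ← S.chartFrame_chartξ p _ hy, ← Finset.smul_sum, ← map_sum] at h
    rw [map_zero, ← h, S.nijenhuis_chartField p hy, map_add, map_smul]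

end IndefiniteGFF

end Chart

/-! ### Linear algebra of a metric `f`-structure on one tangent space -/

section Pointwise

variable {V : Type*} [AddCommGroup V] [Module ℝ V] [TopologicalSpace V]
  {s : ℕ}

/-- A metric framed `f`-structure on a vector space. -/
structure FFrame (ε : Fin s → ℝ) (g : V →L[ℝ] V →L[ℝ] ℝ) (φ : V →L[ℝ] V) (ξ : Fin s → V)
    (η : Fin s → V →L[ℝ] ℝ) : Prop where
  ε_sq (α : Fin s) : ε α * ε α = 1
  symm (v w : V) : g v w = g w v
  nondegenerate (v : V) (hv : ∀ w, g v w = 0) : v = 0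
  φ_sq (v : V) : φ (φ v) = -v + ∑ α, η α v • ξ α
  φ_ξ (α : Fin s) : φ (ξ α) = 0
  η_ξ (α β : Fin s) : η α (ξ β) = if α = β then 1 else 0
  compatible (v w : V) : g (φ v) (φ w) = g v w - ∑ α, ε α * η α v * η α w

namespace FFrame

variable {ε : Fin s → ℝ} {g : V →L[ℝ] V →L[ℝ] ℝ} {φ : V →L[ℝ] V} {ξ : Fin s → V}
  {η : Fin s → V →L[ℝ] ℝ}

theorem ext (h : FFrame ε g φ ξ η) {v w : V} (hvw : ∀ z, g v z = g w z) : v = w := by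
  rw [← sub_eq_zero]
  refine h.nondegenerate _ fun z ↦ ?_
  rw [map_sub, sub_apply, hvw, sub_self]

theorem ε_ne_zero (h : FFrame ε g φ ξ η) (α : Fin s) : ε α ≠ 0 := fun h0 ↦ by
  have := h.ε_sq α
  simp [h0] at this

/-- Computing φ³v in two ways gives Σ η^β(φv) ξ_β = 0, and η^α picks out each coefficient. -/
theorem η_φ (h : FFrame ε g φ ξ η) (α : Fin s) (v : V) : η α (φ v) = 0 := by
  have h1 : ∑ β, η β (φ v) • ξ β = 0 := by
    have h2 := h.φ_sq (φ v)
    rw [h.φ_sq v] at h2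
    simpa [h.φ_ξ] using h2
  have h3 := congrArg (η α) h1
  simpa [h.η_ξ] using h3

theorem g_ξ (h : FFrame ε g φ ξ η) (α : Fin s) (v : V) : g v (ξ α) = ε α * η α v := by
  have h1 := h.compatible v (ξ α)
  simp only [h.φ_ξ, map_zero, h.η_ξ, mul_ite, mul_one, mul_zero, Finset.sum_ite_eq',
    Finset.mem_univ, if_true] at h1
  linarith

theorem g_ξ' (h : FFrame ε g φ ξ η) (α : Fin s) (v : V) : g (ξ α) v = ε α * η α v := by
  rw [h.symm, h.g_ξ]

theorem η_eq (h : FFrame ε g φ ξ η) (α : Fin s) (v : V) : η α v = ε α * g v (ξ α) := by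
  rw [h.g_ξ, ← mul_assoc, h.ε_sq, one_mul]

theorem g_φ (h : FFrame ε g φ ξ η) (v w : V) : g (φ v) w = -g v (φ w) := by
  have h1 := h.compatible v (φ w)
  simp only [mul_zero, Finset.sum_const_zero, sub_zero, h.φ_sq, map_add, map_neg, map_sum,
    map_smul, h.g_ξ, h.η_φ, smul_zero, add_zero] at h1
  linarith

theorem g_φ_φφ (h : FFrame ε g φ ξ η) (v w : V) : g (φ v) (φ (φ w)) = g v (φ w) := by
  simp [h.compatible, h.η_φ]

theorem g_φφ_φ (h : FFrame ε g φ ξ η) (v w : V) : g (φ (φ v)) (φ w) = g (φ v) w := by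
  simp [h.compatible, h.η_φ]

theorem eq_add (h : FFrame ε g φ ξ η) (v : V) : v = -φ (φ v) + ∑ α, η α v • ξ α := by
  rw [h.φ_sq]
  abel

/-- A vector vanishes once its image by `φ` and its `η`-components do. -/
theorem eq_zero_of_φ (h : FFrame ε g φ ξ η) {v : V} (h1 : φ v = 0) (h2 : ∀ α, η α v = 0) :
    v = 0 := by
  rw [h.eq_add v, h1]
  simp [h2]

/-- A linear function vanishes once it does so on the image of `φ` and on the `ξ α`. -/
theorem linear_eq_zero (h : FFrame ε g φ ξ η) {W : Type*} [AddCommGroup W] [Module ℝ W]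
    (f : V →ₗ[ℝ] W) (h1 : ∀ v, f (φ v) = 0) (h2 : ∀ α, f (ξ α) = 0) (v : V) : f v = 0 := by
  rw [h.eq_add v]
  simp [h1, h2]

section Nabla

variable [IsTopologicalAddGroup V] [ContinuousSMul ℝ V] {P : V →L[ℝ] V →L[ℝ] V}
  {X : Fin s → V →L[ℝ] V}

/-- The characteristic vector fields of an `S`-structure are Killing: `∇_v ξ_α = -ε_α φ v`. Here `P`
is the covariant derivative of `φ` and `X α` that of `ξ α`. -/
theorem nabla_ξ (h : FFrame ε g φ ξ η)
    (skew : ∀ v w z, g (P v w) z = -g w (P v z))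
    (closed : ∀ v w z, g (P v w) z + g (P w z) v + g (P z v) w = 0)
    (normal : ∀ v w, P (φ v) w - P (φ w) v + φ (P w v) - φ (P v w) +
      (2 * g v (φ w)) • ∑ α, ξ α = 0)
    (extDer : ∀ α v w, ε α * (g (X α v) w - g (X α w) v) = 2 * g v (φ w))
    (φ_X : ∀ α v, φ (X α v) + P v (ξ α) = 0)
    (X_ξ : ∀ α β v, g (X β v) (ξ α) + g (X α v) (ξ β) = 0) (α : Fin s) (v : V) :
    X α v = -(ε α • φ v) := by
  -- Φ vanishes on ξ_β, hence so does dη^α.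
  have hsym (α β : Fin s) (w : V) : g (X α w) (ξ β) = g (X α (ξ β)) w := by
    have h1 := extDer α (ξ β) w
    rw [h.g_ξ', h.η_φ, mul_zero, mul_zero, mul_eq_zero] at h1
    have := h1.resolve_left (h.ε_ne_zero α)
    linarith
  -- Combines the symmetry `hsym` with the derivative of the constants g(ξ_α, ξ_β).
  have hanti (α β : Fin s) : X α (ξ β) = -X β (ξ α) := by
    refine h.ext fun w ↦ ?_
    have := X_ξ α β w
    rw [hsym, hsym] at this
    simp only [map_neg, neg_apply]
    linarith
  have hP (v : V) (α : Fin s) : P v (ξ α) = -φ (X α v) := by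
    rw [eq_neg_iff_add_eq_zero, add_comm, φ_X]
  -- The Lie derivative of φ along ξ_α vanishes: its image under φ by normality with v = ξ_α, its
  -- η-components by the two relations above.
  have hLie (α : Fin s) (w : V) : P (ξ α) w - X α (φ w) + φ (X α w) = 0 := by
    refine h.eq_zero_of_φ ?_ fun β ↦ ?_
    · have h1 := normal (ξ α) w
      rw [h.φ_ξ, h.g_ξ', h.η_φ, hP, hP] at h1
      simp only [map_zero, zero_apply, mul_zero, zero_smul, add_zero, map_neg] at h1
      rw [map_add, map_sub, ← neg_eq_zero, ← h1]
      abel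
    · rw [h.η_eq, map_add, map_sub, add_apply, sub_apply, skew, hP, hsym, h.g_ξ _ (φ _), h.η_φ,
        map_neg, h.symm w, h.g_φ, hanti β α]
      simp
  -- Closedness of Φ with ξ_α in one slot, and `hLie`, give the Killing equation when one argument
  -- lies in Im φ.
  have hkill (w z : V) : g (X α (φ w)) z + g (X α z) (φ w) = 0 := by
    have h1 := closed (ξ α) w z
    have h2 : P (ξ α) w = X α (φ w) - φ (X α w) := by
      rw [← sub_eq_zero, ← hLie α w]
      abel
    rw [h2, skew w z, hP w, hP z, map_neg, h.symm z, h.g_φ (X α w)] at h1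
    simp only [map_sub, sub_apply, map_neg, neg_apply, h.g_φ] at h1
    linarith
  -- g(∇_{ξ_β} ξ_α, ξ_γ) is symmetric in (β, γ) by `hs` and antisymmetric in (α, β) by `ha`.
  -- Alternating the two six times returns the term to its negative.
  have hzero (β γ : Fin s) : g (X α (ξ β)) (ξ γ) = 0 := by
    have hs (a b c : Fin s) : g (X a (ξ b)) (ξ c) = g (X a (ξ c)) (ξ b) := (hsym a b _).symm
    have ha (a b c : Fin s) : g (X a (ξ b)) (ξ c) = -g (X b (ξ a)) (ξ c) := by
      rw [hanti]
      simp
    linarith [hs α β γ, ha α γ β, hs γ α β, ha γ β α, hs β γ α, ha β α γ]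
  have hK (z w : V) : g (X α w) z + g (X α z) w = 0 := by
    have h1 (β : Fin s) (z : V) : g (X α (ξ β)) z + g (X α z) (ξ β) = 0 := by
      let f : V →ₗ[ℝ] ℝ :=
        { toFun := fun z ↦ g (X α (ξ β)) z + g (X α z) (ξ β)
          map_add' := fun a b ↦ by simp only [map_add, add_apply]; ring
          map_smul' := fun c a ↦ by simp [mul_add] }
      exact h.linear_eq_zero f (fun w ↦ by linarith [hkill w (ξ β)] : ∀ w, _ + _ = (0 : ℝ))
        (fun γ ↦ by simp [f, hzero]) z
    let f : V →ₗ[ℝ] ℝ :=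
      { toFun := fun w ↦ g (X α w) z + g (X α z) w
        map_add' := fun a b ↦ by simp only [map_add, add_apply]; ring
        map_smul' := fun c a ↦ by simp [mul_add] }
    exact h.linear_eq_zero f (fun w ↦ hkill w z) (fun β ↦ h1 β z) w
  -- By the Killing equation the antisymmetrization in the formula for dη^α is twice g(∇_v ξ_α, z).
  refine h.ext fun z ↦ ?_
  have h1 := extDer α v z
  have h2 := hK z v
  have h3 : ε α * g (X α v) z = g v (φ z) := by
    have : g (X α z) v = - g (X α v) z := by linarith
    rw [this] at h1
    linarith
  simp only [map_neg, neg_apply, map_smul, smul_apply, smul_eq_mul, h.g_φ, ← h3]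
  rw [mul_neg, neg_neg, ← mul_assoc, h.ε_sq, one_mul]

/-- The covariant derivative of `φ` on an `S`-manifold. -/
theorem nabla_φ (h : FFrame ε g φ ξ η)
    (skew : ∀ v w z, g (P v w) z = -g w (P v z))
    (closed : ∀ v w z, g (P v w) z + g (P w z) v + g (P z v) w = 0)
    (normal : ∀ v w, P (φ v) w - P (φ w) v + φ (P w v) - φ (P v w) +
      (2 * g v (φ w)) • ∑ α, ξ α = 0)
    (φ_X : ∀ α v, φ (X α v) + P v (ξ α) = 0)
    (φ_sq' : ∀ v w, P v (φ w) + φ (P v w) =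
      ∑ α, ((ε α * g (X α v) w) • ξ α + η α w • X α v))
    (hX : ∀ α v, X α v = -(ε α • φ v)) (v w : V) :
    P v w = g (φ v) (φ w) • (∑ α, ξ α) + (∑ α, ε α * η α w) • φ (φ v) := by
  set b : V → ℝ := fun w ↦ ∑ α, ε α * η α w with hb
  have hbφ (w : V) : b (φ w) = 0 := by simp [hb, h.η_φ]
  have hbξ (w : V) : g (∑ α, ξ α) w = b w := by
    simp [hb, h.g_ξ']
  let Q (v w z : V) : ℝ := g (P v w) z - (g (φ v) (φ w) * b z - b w * g (φ v) (φ z))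
  have Qskew (v w z) : Q v w z = -Q v z w := by
    simp only [Q]
    rw [skew, h.symm w]
    ring
  have Qcyc (v w z) : Q v w z + Q w z v + Q z v w = 0 := by
    simp only [Q]
    rw [h.symm (φ w) (φ v), h.symm (φ z) (φ v), h.symm (φ z) (φ w)]
    linarith [closed v w z]
  -- The covariant derivative of φ² = -I + Σ η^α ⊗ ξ_α, with ∇ξ_α inserted.
  have Qφ (v w z) : Q v (φ w) z = Q v w (φ z) := by
    have h1 := congrArg (fun u ↦ g u z) (φ_sq' v w)
    have h2 : ∑ α, ((ε α * g (X α v) w) • ξ α + η α w • X α v) =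
        g v (φ w) • (∑ α, ξ α) - b w • φ v := by
      simp only [hX, hb, Finset.sum_add_distrib, Finset.smul_sum, Finset.sum_smul, sub_eq_add_neg,
        ← Finset.sum_neg_distrib]
      congr 1
      · refine Finset.sum_congr rfl fun α _ ↦ ?_
        simp only [map_neg, neg_apply, map_smul, smul_apply, smul_eq_mul, h.g_φ, mul_neg]
        rw [neg_neg, ← mul_assoc, h.ε_sq, one_mul]
      · refine Finset.sum_congr rfl fun α _ ↦ ?_
        rw [smul_neg, smul_smul, mul_comm]
    rw [h2] at h1
    simp only [map_add, add_apply, map_sub, sub_apply, map_smul, smul_apply, smul_eq_mul, hbξ,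
      h.g_φ] at h1
    simp only [Q, hbφ, h.g_φ_φφ]
    linarith
  have Qnormal (v w z) : Q (φ v) w z - Q (φ w) v z - Q w v (φ z) + Q v w (φ z) = 0 := by
    have h1 := congrArg (fun u ↦ g u z) (normal v w)
    simp only [map_add, add_apply, map_sub, sub_apply, map_smul, smul_apply, smul_eq_mul, hbξ,
      h.g_φ (P _ _), map_zero, zero_apply] at h1
    simp only [Q, hbφ, h.g_φ_φφ, h.g_φφ_φ, h.symm (φ w) v, h.g_φ v, h.g_φ w]
    linarith
  -- Normality and the cyclic identity give a + b = c for the three cyclic terms a, b, c. Rotating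
  -- the arguments gives c + a = b and b + c = a, so all three vanish.
  have Qφ_left (v w z) : Q (φ v) w z = 0 := by
    have key (v w z) : Q (φ v) w z + Q (φ w) z v = Q (φ z) v w := by
      have h1 := Qcyc v w (φ z)
      rw [Qskew w (φ z) v] at h1
      linarith [Qnormal v w z, Qskew (φ w) v z]
    linarith [key v w z, key z v w, key w z v]
  have Qξξ (v : V) (α β : Fin s) : Q v (ξ α) (ξ β) = 0 := by
    have h1 : P v (ξ α) = -φ (X α v) := by
      rw [eq_neg_iff_add_eq_zero, add_comm, φ_X]
    simp [Q, h1, h.g_ξ, h.η_φ, h.φ_ξ]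
  -- In the cyclic identity one term vanishes by `Qφ_left`; in another φ can be moved onto ξ_α,
  -- which it kills.
  have Qφ_right (α : Fin s) (w z : V) : Q (ξ α) w (φ z) = 0 := by
    have h1 := Qcyc (ξ α) w (φ z)
    have h2 : Q w (φ z) (ξ α) = 0 := by
      rw [Qφ, h.φ_ξ]
      simp [Q, hb]
    linarith [Qφ_left z (ξ α) w]
  have Qlin (v w : V) (hξ : ∀ α, Q v w (ξ α) = 0) (hφ : ∀ z, Q v w (φ z) = 0) (z : V) :
      Q v w z = 0 := by
    let f : V →ₗ[ℝ] ℝ :=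
      { toFun := Q v w
        map_add' := fun a c ↦ by
          simp only [Q, hb, map_add, mul_add, Finset.sum_add_distrib]; ring
        map_smul' := fun c a ↦ by
          simp only [Q, hb, map_smul, smul_eq_mul, RingHom.id_apply, mul_left_comm _ c,
            ← Finset.mul_sum]
          ring }
    exact h.linear_eq_zero f hφ hξ z
  have Qξ (α : Fin s) (w z : V) : Q (ξ α) w z = 0 := by
    refine Qlin _ _ (fun β ↦ ?_) (Qφ_right α w) z
    rw [Qskew, neg_eq_zero]
    exact Qlin _ _ (fun γ ↦ Qξξ _ _ _) (Qφ_right α _) w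
  have Qzero (v w z : V) : Q v w z = 0 := by
    let f : V →ₗ[ℝ] ℝ :=
      { toFun := fun v ↦ Q v w z
        map_add' := fun a c ↦ by simp only [Q, map_add, add_apply]; ring
        map_smul' := fun c a ↦ by
          simp only [Q, map_smul, smul_apply, smul_eq_mul, RingHom.id_apply]; ring }
    exact h.linear_eq_zero f (fun v ↦ Qφ_left v w z) (fun α ↦ Qξ α w z) v
  refine h.ext fun z ↦ ?_
  have h1 := Qzero v w z
  simp only [map_add, add_apply, map_smul, smul_apply, smul_eq_mul, hbξ, h.g_φ (φ v)]
  simp only [Q] at h1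
  change _ = _ + b w * _
  linarith

end Nabla

end FFrame

end Pointwise

/-! ### The Levi-Civita connection in coordinates -/

section LocalMetric

variable {E : Type*} [NormedAddCommGroup E] [NormedSpace ℝ E]

theorem fderiv_fderiv_comm {F : Type*} [NormedAddCommGroup F] [NormedSpace ℝ F] {f : E → F}
    {U : Set E} (hU : IsOpen U) (hf : ContDiffOn ℝ ∞ f U) {y : E} (hy : y ∈ U) (v w : E) :
    fderiv ℝ (fderiv ℝ f) y v w = fderiv ℝ (fderiv ℝ f) y w v :=
  ((hf.contDiffAt (hU.mem_nhds hy)).isSymmSndFDerivAt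
    (by rw [minSmoothness_of_isRCLikeNormedField]; exact ENat.LEInfty.out)) v w

theorem hasFDerivAt_of_contDiffOn {F : Type*} [NormedAddCommGroup F] [NormedSpace ℝ F] {f : E → F}
    {U : Set E} (hU : IsOpen U) (hf : ContDiffOn ℝ ∞ f U) {y : E} (hy : y ∈ U) :
    HasFDerivAt f (fderiv ℝ f y) y :=
  ((hf.contDiffAt (hU.mem_nhds hy)).differentiableAt (by simp)).hasFDerivAt

/-- Functions that agree on an open set have the same derivatives there. -/
theorem hasFDerivAt_congr_apply {F : Type*} [NormedAddCommGroup F] [NormedSpace ℝ F] {f g : E → F}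
    {f' g' : E →L[ℝ] F} {U : Set E} (hU : IsOpen U) {y : E} (hy : y ∈ U)
    (hf : HasFDerivAt f f' y) (hg : HasFDerivAt g g' y) (hfg : ∀ z ∈ U, f z = g z) (v : E) :
    f' v = g' v := by
  have h : f =ᶠ[𝓝 y] g := by
    filter_upwards [hU.mem_nhds hy] with z hz using hfg z hz
  rw [hf.unique (hg.congr_of_eventuallyEq h)]

/-- The coefficients `G` of a semi-Riemannian metric on an open subset `U` of a vector space. -/
structure LocalMetric (U : Set E) (G : E → E →L[ℝ] E →L[ℝ] ℝ) : Prop where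
  isOpen : IsOpen U
  contDiff_G : ContDiffOn ℝ ∞ G U
  symm {y : E} (hy : y ∈ U) (v w : E) : G y v w = G y w v
  nondegenerate {y : E} (hy : y ∈ U) (v : E) (hv : ∀ w, G y v w = 0) : v = 0

namespace LocalMetric

variable {U : Set E} {G : E → E →L[ℝ] E →L[ℝ] ℝ}

theorem localCurvature_swap (G : E → E →L[ℝ] E →L[ℝ] ℝ) (y v w z : E) :
    localCurvature G y v w z = -localCurvature G y w v z := by
  simp only [localCurvature]
  abel

theorem ext (L : LocalMetric U G) {y : E} (hy : y ∈ U) {v w : E} (h : ∀ z, G y v z = G y w z) :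
    v = w := by
  rw [← sub_eq_zero]
  refine L.nondegenerate hy _ fun z ↦ ?_
  rw [map_sub, sub_apply, h, sub_self]

theorem hasFDerivAt_G (L : LocalMetric U G) {y : E} (hy : y ∈ U) :
    HasFDerivAt G (fderiv ℝ G y) y :=
  hasFDerivAt_of_contDiffOn L.isOpen L.contDiff_G hy

theorem fderiv_symm (L : LocalMetric U G) {y : E} (hy : y ∈ U) (u v w : E) :
    fderiv ℝ G y u v w = fderiv ℝ G y u w v := by
  have hG := L.hasFDerivAt_G hy
  have := hasFDerivAt_congr_apply L.isOpen hy
    ((hG.clm_apply (hasFDerivAt_const v y)).clm_apply (hasFDerivAt_const w y))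
    ((hG.clm_apply (hasFDerivAt_const w y)).clm_apply (hasFDerivAt_const v y))
    (fun z hz ↦ L.symm hz v w) u
  simpa using this

variable [FiniteDimensional ℝ E]

/-- The metric as an isomorphism from `E` to its dual. -/
theorem exists_equiv (L : LocalMetric U G) {y : E} (hy : y ∈ U) :
    ∃ e : E ≃L[ℝ] (E →L[ℝ] ℝ), (e : E →L[ℝ] E →L[ℝ] ℝ) = G y := by
  have hinj : Function.Injective (G y).toLinearMap := by
    rw [← LinearMap.ker_eq_bot, LinearMap.ker_eq_bot']
    exact fun v hv ↦ L.nondegenerate hy v fun w ↦ DFunLike.congr_fun hv w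
  have hrank : Module.finrank ℝ E = Module.finrank ℝ (E →L[ℝ] ℝ) := by
    rw [← (LinearMap.toContinuousLinearMap : (E →ₗ[ℝ] ℝ) ≃ₗ[ℝ] (E →L[ℝ] ℝ)).finrank_eq]
    exact (Subspace.dual_finrank_eq (K := ℝ) (V := E)).symm
  exact ⟨(LinearEquiv.ofInjectiveOfFinrankEq _ hinj hrank).toContinuousLinearEquiv, rfl⟩

theorem apply_christoffel (L : LocalMetric U G) {y : E} (hy : y ∈ U) (v w z : E) :
    G y (christoffel G y v w) z = christoffelLower G y v w z := by
  obtain ⟨e, he⟩ := L.exists_equiv hy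
  change G y ((G y).inverse (christoffelLower G y v w)) z = _
  rw [← he, ContinuousLinearMap.inverse_equiv]
  simp

theorem christoffel_symm (L : LocalMetric U G) {y : E} (hy : y ∈ U) (v w : E) :
    christoffel G y v w = christoffel G y w v := by
  refine L.ext hy fun z ↦ ?_
  rw [L.apply_christoffel hy, L.apply_christoffel hy, christoffelLower_apply,
    christoffelLower_apply, L.fderiv_symm hy z v w]
  ring

/-- The Levi-Civita connection is metric. -/
theorem fderiv_apply (L : LocalMetric U G) {y : E} (hy : y ∈ U) (u v w : E) :
    fderiv ℝ G y u v w = G y (christoffel G y u v) w + G y v (christoffel G y u w) := by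
  rw [L.symm hy v, L.apply_christoffel hy, L.apply_christoffel hy, christoffelLower_apply,
    christoffelLower_apply, L.fderiv_symm hy u w v, L.fderiv_symm hy w u v,
    L.fderiv_symm hy v u w]
  ring

theorem contDiffOn_christoffel (L : LocalMetric U G) : ContDiffOn ℝ ∞ (christoffel G) U := by
  have : CompleteSpace E := FiniteDimensional.complete ℝ E
  have hD : ContDiffOn ℝ ∞ (fderiv ℝ G) U := L.contDiff_G.fderiv_of_isOpen L.isOpen (by simp)
  have hD' (u v w : E) : ContDiffOn ℝ ∞ (fun y ↦ fderiv ℝ G y u v w) U :=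
    ((hD.clm_apply contDiffOn_const).clm_apply contDiffOn_const).clm_apply contDiffOn_const
  have hlow : ContDiffOn ℝ ∞ (christoffelLower G) U := by
    refine contDiffOn_clm_apply.2 fun v ↦ contDiffOn_clm_apply.2 fun w ↦
      contDiffOn_clm_apply.2 fun z ↦ ?_
    simp only [christoffelLower_apply]
    exact contDiffOn_const.mul (((hD' v w z).add (hD' w v z)).sub (hD' z v w))
  refine contDiffOn_clm_apply.2 fun v ↦ contDiffOn_clm_apply.2 fun w y hy ↦ ?_
  change ContDiffWithinAt ℝ ∞ (fun y ↦ (G y).inverse (christoffelLower G y v w)) U y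
  refine ContDiffWithinAt.clm_apply ?_
    (((hlow.clm_apply contDiffOn_const).clm_apply contDiffOn_const) y hy)
  obtain ⟨e, he⟩ := L.exists_equiv hy
  -- Inversion of operators is smooth at an isomorphism, and nondegeneracy makes the metric one.
  have hinv : ContDiffAt ℝ ∞ ContinuousLinearMap.inverse (G y) := by
    rw [← he]
    exact contDiffAt_map_inverse e
  exact hinv.comp_contDiffWithinAt y (L.contDiff_G y hy)

theorem hasFDerivAt_christoffel (L : LocalMetric U G) {y : E} (hy : y ∈ U) :
    HasFDerivAt (christoffel G) (fderiv ℝ (christoffel G) y) y :=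
  hasFDerivAt_of_contDiffOn L.isOpen L.contDiffOn_christoffel hy

theorem fderiv_christoffel_symm (L : LocalMetric U G) {y : E} (hy : y ∈ U) (u v w : E) :
    fderiv ℝ (christoffel G) y u v w = fderiv ℝ (christoffel G) y u w v := by
  have hΓ := L.hasFDerivAt_christoffel hy
  have := hasFDerivAt_congr_apply L.isOpen hy
    ((hΓ.clm_apply (hasFDerivAt_const v y)).clm_apply (hasFDerivAt_const w y))
    ((hΓ.clm_apply (hasFDerivAt_const w y)).clm_apply (hasFDerivAt_const v y))
    (fun z hz ↦ L.christoffel_symm hz v w) u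
  simpa using this

/-- Torsion-freeness: the Christoffel symbols and their derivatives are symmetric, so the cyclic sum
cancels in pairs. -/
theorem localCurvature_bianchi (L : LocalMetric U G) {y : E} (hy : y ∈ U) (v w z : E) :
    localCurvature G y v w z + localCurvature G y w z v + localCurvature G y z v w = 0 := by
  simp only [localCurvature]
  rw [L.fderiv_christoffel_symm hy v w z, L.fderiv_christoffel_symm hy w z v,
    L.fderiv_christoffel_symm hy z v w, L.christoffel_symm hy w z, L.christoffel_symm hy v z,
    L.christoffel_symm hy w v]
  abel

/-- The metric property of the connection is differentiated a second time. In the antisymmetrization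
over v and w the second derivatives of `G` cancel, and so do the products of two first-order terms.
-/
theorem localCurvature_skew (L : LocalMetric U G) {y : E} (hy : y ∈ U) (v w z u : E) :
    G y (localCurvature G y v w z) u = -G y z (localCurvature G y v w u) := by
  have hG := L.hasFDerivAt_G hy
  have hΓ := L.hasFDerivAt_christoffel hy
  have hDG : HasFDerivAt (fderiv ℝ G) (fderiv ℝ (fderiv ℝ G) y) y :=
    hasFDerivAt_of_contDiffOn L.isOpen (L.contDiff_G.fderiv_of_isOpen L.isOpen (by simp)) hy
  have key (v w : E) : fderiv ℝ (fderiv ℝ G) y v w z u =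
      G y (fderiv ℝ (christoffel G) y v w z) u + G y z (fderiv ℝ (christoffel G) y v w u) +
      (G y (christoffel G y v (christoffel G y w z)) u +
        G y (christoffel G y w z) (christoffel G y v u)) +
      (G y (christoffel G y v z) (christoffel G y w u) +
        G y z (christoffel G y v (christoffel G y w u))) := by
    have h1 := hasFDerivAt_congr_apply L.isOpen hy
      (((hDG.clm_apply (hasFDerivAt_const w y)).clm_apply (hasFDerivAt_const z y)).clm_apply
        (hasFDerivAt_const u y))
      (((hG.clm_apply ((hΓ.clm_apply (hasFDerivAt_const w y)).clm_apply
          (hasFDerivAt_const z y))).clm_apply (hasFDerivAt_const u y)).add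
        ((hG.clm_apply (hasFDerivAt_const z y)).clm_apply
          ((hΓ.clm_apply (hasFDerivAt_const w y)).clm_apply (hasFDerivAt_const u y))))
      (fun x hx ↦ L.fderiv_apply hx w z u) v
    simp only [add_apply, ContinuousLinearMap.comp_apply, ContinuousLinearMap.flip_apply,
      zero_apply, map_zero, zero_add] at h1
    rw [h1, L.fderiv_apply hy v, L.fderiv_apply hy v]
    ring
  have h1 := key v w
  have h2 := key w v
  rw [fderiv_fderiv_comm L.isOpen L.contDiff_G hy v w] at h1
  simp only [localCurvature, map_sub, map_add, sub_apply, add_apply]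
  linarith

end LocalMetric

end LocalMetric

/-! ### The Levi-Civita connection of an `S`-structure in coordinates -/

namespace LocalSStructure

variable {E : Type*} [NormedAddCommGroup E] [NormedSpace ℝ E] {s : ℕ} {U : Set E} {ε : Fin s → ℝ}
  {G : E → E →L[ℝ] E →L[ℝ] ℝ} {φ : E → E →L[ℝ] E} {ξ : Fin s → E → E}
  {η : Fin s → E → E →L[ℝ] ℝ}

theorem localMetric (L : LocalSStructure U ε G φ ξ η) : LocalMetric U G :=
  ⟨L.isOpen, L.contDiff_G, L.symm, L.nondegenerate⟩

theorem fFrame (L : LocalSStructure U ε G φ ξ η) {y : E} (hy : y ∈ U) :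
    FFrame ε (G y) (φ y) (fun α ↦ ξ α y) (fun α ↦ η α y) :=
  ⟨L.ε_sq, L.symm hy, L.nondegenerate hy, L.φ_sq hy, L.φ_ξ hy, L.η_ξ hy, L.compatible hy⟩

theorem hasFDerivAt_φ (L : LocalSStructure U ε G φ ξ η) {y : E} (hy : y ∈ U) :
    HasFDerivAt φ (fderiv ℝ φ y) y :=
  hasFDerivAt_of_contDiffOn L.isOpen L.contDiff_φ hy

theorem hasFDerivAt_ξ (L : LocalSStructure U ε G φ ξ η) {y : E} (hy : y ∈ U) (α : Fin s) :
    HasFDerivAt (ξ α) (fderiv ℝ (ξ α) y) y :=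
  hasFDerivAt_of_contDiffOn L.isOpen (L.contDiff_ξ α) hy

theorem hasFDerivAt_η (L : LocalSStructure U ε G φ ξ η) {y : E} (hy : y ∈ U) (α : Fin s) :
    HasFDerivAt (η α) (fderiv ℝ (η α) y) y :=
  hasFDerivAt_of_contDiffOn L.isOpen (L.contDiff_η α) hy

/-- The covariant derivative of the endomorphism field `φ`. -/
def nablaEnd (G : E → E →L[ℝ] E →L[ℝ] ℝ) (φ : E → E →L[ℝ] E) (y : E) : E →L[ℝ] E →L[ℝ] E :=
  fderiv ℝ φ y + (ContinuousLinearMap.compL ℝ E E E).flip (φ y) ∘L christoffel G y -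
    ContinuousLinearMap.compL ℝ E E E (φ y) ∘L christoffel G y

theorem nablaEnd_apply (G : E → E →L[ℝ] E →L[ℝ] ℝ) (φ : E → E →L[ℝ] E) (y v w : E) :
    nablaEnd G φ y v w =
      fderiv ℝ φ y v w + christoffel G y v (φ y w) - φ y (christoffel G y v w) :=
  rfl

/-- The covariant derivative of the vector field `ξ`. -/
def nablaField (G : E → E →L[ℝ] E →L[ℝ] ℝ) (ξ : E → E) (y : E) : E →L[ℝ] E :=
  fderiv ℝ ξ y + (christoffel G y).flip (ξ y)

theorem nablaField_apply (G : E → E →L[ℝ] E →L[ℝ] ℝ) (ξ : E → E) (y v : E) :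
    nablaField G ξ y v = fderiv ℝ ξ y v + christoffel G y v (ξ y) :=
  rfl

theorem φ_nablaField (L : LocalSStructure U ε G φ ξ η) {y : E} (hy : y ∈ U) (α : Fin s) (v : E) :
    φ y (nablaField G (ξ α) y v) + nablaEnd G φ y v (ξ α y) = 0 := by
  have h1 := hasFDerivAt_congr_apply L.isOpen hy
    ((L.hasFDerivAt_φ hy).clm_apply (L.hasFDerivAt_ξ hy α)) (hasFDerivAt_const 0 y)
    (fun x hx ↦ L.φ_ξ hx α) v
  simp only [add_apply, ContinuousLinearMap.comp_apply, ContinuousLinearMap.flip_apply,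
    zero_apply] at h1
  rw [nablaField_apply, nablaEnd_apply, L.φ_ξ hy, map_zero, add_zero, map_add, ← h1]
  abel

variable [FiniteDimensional ℝ E]

/-- The covariant derivative of the skew-adjointness of φ. -/
theorem nabla_skew (L : LocalSStructure U ε G φ ξ η) {y : E} (hy : y ∈ U) (v w z : E) :
    G y (nablaEnd G φ y v w) z = -G y w (nablaEnd G φ y v z) := by
  have hG := L.localMetric.hasFDerivAt_G hy
  have hφ := L.hasFDerivAt_φ hy
  have h1 := hasFDerivAt_congr_apply L.isOpen hy
    ((hG.clm_apply (hφ.clm_apply (hasFDerivAt_const w y))).clm_apply (hasFDerivAt_const z y))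
    ((hG.clm_apply (hasFDerivAt_const w y)).clm_apply
      (hφ.clm_apply (hasFDerivAt_const z y))).neg
    (fun x hx ↦ (L.fFrame hx).g_φ w z) v
  simp only [add_apply, ContinuousLinearMap.comp_apply, ContinuousLinearMap.flip_apply,
    zero_apply, map_zero, zero_add, neg_apply] at h1
  rw [L.localMetric.fderiv_apply hy, L.localMetric.fderiv_apply hy] at h1
  have h2 := (L.fFrame hy).g_φ (christoffel G y v w) z
  have h3 := (L.fFrame hy).g_φ w (christoffel G y v z)
  simp only [nablaEnd_apply, map_add, map_sub, add_apply, sub_apply]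
  linarith

/-- Φ = dη^0 is exact, hence closed: second derivatives of `η 0` commute. Torsion-freeness turns the
partial derivatives into covariant ones. -/
theorem nabla_closed (L : LocalSStructure U ε G φ ξ η) [NeZero s] {y : E} (hy : y ∈ U)
    (v w z : E) : G y (nablaEnd G φ y v w) z + G y (nablaEnd G φ y w z) v +
      G y (nablaEnd G φ y z v) w = 0 := by
  have hG := L.localMetric.hasFDerivAt_G hy
  have hφ := L.hasFDerivAt_φ hy
  have hDη : HasFDerivAt (fderiv ℝ (η 0)) (fderiv ℝ (fderiv ℝ (η 0)) y) y :=
    hasFDerivAt_of_contDiffOn L.isOpen ((L.contDiff_η 0).fderiv_of_isOpen L.isOpen (by simp)) hy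
  have key (a b c : E) : fderiv ℝ (fderiv ℝ (η 0)) y a b c - fderiv ℝ (fderiv ℝ (η 0)) y a c b =
      2 * (G y (nablaEnd G φ y a c) b + G y (christoffel G y a b) (φ y c) -
        G y (christoffel G y a c) (φ y b)) := by
    have h1 := hasFDerivAt_congr_apply L.isOpen hy
      (((hDη.clm_apply (hasFDerivAt_const b y)).clm_apply (hasFDerivAt_const c y)).sub
        ((hDη.clm_apply (hasFDerivAt_const c y)).clm_apply (hasFDerivAt_const b y)))
      (((hG.clm_apply (hasFDerivAt_const b y)).clm_apply
        (hφ.clm_apply (hasFDerivAt_const c y))).const_mul 2)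
      (fun x hx ↦ L.extDer_η hx 0 b c) a
    simp only [add_apply, sub_apply, ContinuousLinearMap.comp_apply,
      ContinuousLinearMap.flip_apply, zero_apply, map_zero, zero_add, smul_apply,
      smul_eq_mul] at h1
    rw [L.localMetric.fderiv_apply hy] at h1
    have h2 := (L.fFrame hy).g_φ (christoffel G y a c) b
    simp only [nablaEnd_apply, map_add, map_sub, add_apply, sub_apply]
    rw [h1, h2, L.symm hy b, L.symm hy b]
    ring
  have h1 := key v w z
  have h2 := key w z v
  have h3 := key z v w
  have hc (a b c : E) := DFunLike.congr_fun
    (fderiv_fderiv_comm L.isOpen (L.contDiff_η 0) hy a b) c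
  rw [hc v w] at h1
  rw [hc w z] at h2
  rw [hc z v] at h3
  rw [L.localMetric.christoffel_symm hy w v] at h2
  rw [L.localMetric.christoffel_symm hy z v, L.localMetric.christoffel_symm hy z w] at h3
  have h4 := L.nabla_skew hy v w z
  have h5 := L.nabla_skew hy w z v
  have h6 := L.nabla_skew hy z v w
  rw [L.symm hy w] at h4
  rw [L.symm hy z] at h5
  rw [L.symm hy v] at h6
  linarith

/-- The connection has no torsion, so the Christoffel terms cancel when partial derivatives are
replaced by covariant ones. -/
theorem nabla_normal (L : LocalSStructure U ε G φ ξ η) {y : E} (hy : y ∈ U) (v w : E) :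
    nablaEnd G φ y (φ y v) w - nablaEnd G φ y (φ y w) v + φ y (nablaEnd G φ y w v) -
      φ y (nablaEnd G φ y v w) + (2 * G y v (φ y w)) • ∑ α, ξ α y = 0 := by
  rw [← L.normal hy v w]
  simp only [nablaEnd_apply, map_add, map_sub]
  rw [L.localMetric.christoffel_symm hy (φ y v) (φ y w),
    L.localMetric.christoffel_symm hy (φ y v) w, L.localMetric.christoffel_symm hy (φ y w) v,
    L.localMetric.christoffel_symm hy v w]
  abel

/-- The derivative of g(ξ_α, w) = ε_α η^α(w); it lets dη^α be expressed through ∇ξ_α. -/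
theorem g_nablaField (L : LocalSStructure U ε G φ ξ η) {y : E} (hy : y ∈ U) (α : Fin s)
    (v w : E) : G y (nablaField G (ξ α) y v) w =
      ε α * (fderiv ℝ (η α) y v w - η α y (christoffel G y v w)) := by
  have hG := L.localMetric.hasFDerivAt_G hy
  have h1 := hasFDerivAt_congr_apply L.isOpen hy
    ((hG.clm_apply (L.hasFDerivAt_ξ hy α)).clm_apply (hasFDerivAt_const w y))
    (((L.hasFDerivAt_η hy α).clm_apply (hasFDerivAt_const w y)).const_mul (ε α))
    (fun x hx ↦ (L.fFrame hx).g_ξ' α w) v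
  simp only [add_apply, ContinuousLinearMap.comp_apply, ContinuousLinearMap.flip_apply,
    zero_apply, map_zero, zero_add, smul_apply, smul_eq_mul] at h1
  rw [L.localMetric.fderiv_apply hy, (L.fFrame hy).g_ξ' α] at h1
  simp only [nablaField_apply, map_add, add_apply]
  linarith

theorem nablaField_eq (L : LocalSStructure U ε G φ ξ η) [NeZero s] {y : E} (hy : y ∈ U)
    (α : Fin s) (v : E) : nablaField G (ξ α) y v = -(ε α • φ y v) := by
  refine (L.fFrame hy).nabla_ξ (X := fun α ↦ nablaField G (ξ α) y) (L.nabla_skew hy)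
    (L.nabla_closed hy) (L.nabla_normal hy) (fun α v w ↦ ?_) (L.φ_nablaField hy)
    (fun α β v ↦ ?_) α v
  · rw [L.g_nablaField hy, L.g_nablaField hy, L.localMetric.christoffel_symm hy w v, ← mul_sub,
      ← mul_assoc, L.ε_sq, one_mul, ← L.extDer_η hy α]
    ring
  -- The products g(ξ_β, ξ_α) are constant, so their derivative vanishes.
  · have hG := L.localMetric.hasFDerivAt_G hy
    have h1 := hasFDerivAt_congr_apply L.isOpen hy
      ((hG.clm_apply (L.hasFDerivAt_ξ hy β)).clm_apply (L.hasFDerivAt_ξ hy α))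
      (hasFDerivAt_const (ε α * if α = β then 1 else 0) y)
      (fun x hx ↦ by rw [(L.fFrame hx).g_ξ, L.η_ξ hx]) v
    simp only [add_apply, ContinuousLinearMap.comp_apply, ContinuousLinearMap.flip_apply,
      zero_apply] at h1
    rw [L.localMetric.fderiv_apply hy, L.symm hy (ξ β y), L.symm hy (ξ β y)] at h1
    simp only [nablaField_apply, map_add, add_apply]
    linarith

theorem nablaEnd_eq (L : LocalSStructure U ε G φ ξ η) [NeZero s] {y : E} (hy : y ∈ U) (v w : E) :
    nablaEnd G φ y v w = G y (φ y v) (φ y w) • (∑ α, ξ α y) +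
      (∑ α, ε α * η α y w) • φ y (φ y v) := by
  refine (L.fFrame hy).nabla_φ (X := fun α ↦ nablaField G (ξ α) y) (L.nabla_skew hy)
    (L.nabla_closed hy) (L.nabla_normal hy) (L.φ_nablaField hy) (fun v w ↦ ?_)
    (L.nablaField_eq hy) v w
  have hφ := L.hasFDerivAt_φ hy
  -- Differentiates φ²w = -w + Σ η^α(w) ξ_α for fixed w; the Christoffel terms are put back below.
  have h1 := hasFDerivAt_congr_apply L.isOpen hy
    (hφ.clm_apply (hφ.clm_apply (hasFDerivAt_const w y)))
    ((HasFDerivAt.fun_sum (u := Finset.univ) fun α _ ↦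
      ((L.hasFDerivAt_η hy α).clm_apply (hasFDerivAt_const w y)).smul
        (L.hasFDerivAt_ξ hy α)).const_add (-w))
    (fun x hx ↦ L.φ_sq hx w) v
  simp only [add_apply, ContinuousLinearMap.comp_apply, ContinuousLinearMap.flip_apply,
    zero_apply, map_zero, zero_add, sum_apply, smul_apply,
    ContinuousLinearMap.smulRight_apply] at h1
  have h2 (α : Fin s) : ε α * G y (nablaField G (ξ α) y v) w =
      fderiv ℝ (η α) y v w - η α y (christoffel G y v w) := by
    rw [L.g_nablaField hy, ← mul_assoc, L.ε_sq, one_mul]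
  simp only [h2]
  simp only [nablaField_apply, sub_smul, smul_add]
  rw [nablaEnd_apply, nablaEnd_apply, L.φ_sq hy w, map_sub, map_add,
    L.φ_sq hy (christoffel G y v w)]
  simp only [map_add, map_neg, map_sum, map_smul]
  simp only [Finset.sum_add_distrib, Finset.sum_sub_distrib] at h1 ⊢
  rw [← sub_eq_zero] at h1 ⊢
  rw [← h1]
  abel

/-- The Ricci identity: R(v, w)ξ_α is the antisymmetrized second covariant derivative of ξ_α, and
the first one is -ε_α φ. -/
theorem localCurvature_ξ (L : LocalSStructure U ε G φ ξ η) [NeZero s] {y : E} (hy : y ∈ U)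
    (α : Fin s) (v w : E) : localCurvature G y v w (ξ α y) =
      -(ε α • (nablaEnd G φ y v w - nablaEnd G φ y w v)) := by
  have hΓ := L.localMetric.hasFDerivAt_christoffel hy
  have hDξ : HasFDerivAt (fderiv ℝ (ξ α)) (fderiv ℝ (fderiv ℝ (ξ α)) y) y :=
    hasFDerivAt_of_contDiffOn L.isOpen ((L.contDiff_ξ α).fderiv_of_isOpen L.isOpen (by simp)) hy
  have hξ (v : E) : fderiv ℝ (ξ α) y v = -(ε α • φ y v) - christoffel G y v (ξ α y) := by
    rw [← L.nablaField_eq hy, nablaField_apply, add_sub_cancel_right]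
  have key (v w : E) : fderiv ℝ (fderiv ℝ (ξ α)) y v w +
      (fderiv ℝ (christoffel G) y v w (ξ α y) - christoffel G y w (christoffel G y v (ξ α y))) =
      ε α • christoffel G y w (φ y v) - ε α • fderiv ℝ φ y v w := by
    have h1 := hasFDerivAt_congr_apply L.isOpen hy
      ((hDξ.clm_apply (hasFDerivAt_const w y)).add
        ((hΓ.clm_apply (hasFDerivAt_const w y)).clm_apply (L.hasFDerivAt_ξ hy α)))
      (((L.hasFDerivAt_φ hy).clm_apply (hasFDerivAt_const w y)).const_smul (ε α)).neg
      (fun x hx ↦ L.nablaField_eq hx α w) v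
    simp only [add_apply, ContinuousLinearMap.comp_apply, ContinuousLinearMap.flip_apply,
      zero_apply, map_zero, zero_add, neg_apply, smul_apply] at h1
    rw [hξ, map_sub, map_neg, map_smul] at h1
    rw [← sub_eq_zero] at h1 ⊢
    rw [← h1]
    abel
  have h1 := key v w
  have h2 := key w v
  rw [fderiv_fderiv_comm L.isOpen (L.contDiff_ξ α) hy v w] at h1
  rw [localCurvature, nablaEnd_apply, nablaEnd_apply, L.localMetric.christoffel_symm hy v w]
  simp only [smul_sub, smul_add]
  rw [← sub_eq_zero] at h1 h2 ⊢
  rw [← sub_zero (0 : E)]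
  nth_rw 1 [← h1]
  rw [← h2]
  abel

/-- The commutator of the curvature with `φ`, on vectors of the image of `φ`. -/
theorem localCurvature_φ (L : LocalSStructure U ε G φ ξ η) [NeZero s] {y : E} (hy : y ∈ U)
    (v w : E) {z u : E} (hz : ∀ α, η α y z = 0) (hu : ∀ α, η α y u = 0) :
    G y (localCurvature G y v w (φ y z)) u - G y (φ y (localCurvature G y v w z)) u =
      (∑ α, ε α) * (G y (φ y v) z * G y w u - G y w z * G y (φ y v) u -
        (G y (φ y w) z * G y v u - G y v z * G y (φ y w) u)) := by
  have hF := L.fFrame hy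
  have hG := L.localMetric.hasFDerivAt_G hy
  have hΓ := L.localMetric.hasFDerivAt_christoffel hy
  have hφ := L.hasFDerivAt_φ hy
  have hDφ : HasFDerivAt (fderiv ℝ φ) (fderiv ℝ (fderiv ℝ φ) y) y :=
    hasFDerivAt_of_contDiffOn L.isOpen (L.contDiff_φ.fderiv_of_isOpen L.isOpen (by simp)) hy
  -- Since ξ̄ ⟂ u and η̄(z) = 0, the derivatives of g(φw, φz) and of φ²w drop out below. Only the
  -- derivatives of the ξ_α and η^α survive, and each contributes a factor Σ ε_α.
  have hξu : G y (∑ α, ξ α y) u = 0 := by simp [hF.g_ξ', hu]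
  have hzz (a : E) : G y (φ y a) (φ y z) = G y a z := by simp [hF.compatible, hz]
  have huu (a : E) : G y (φ y (φ y a)) u = -G y a u := by
    rw [hF.g_φ, hF.compatible]
    simp [hu]
  set e : ℝ := ∑ α, ε α with he
  set β : E → ℝ := fun a ↦ ∑ α, ε α * η α y a with hβ
  have hβz : β z = 0 := by simp [hβ, hz]
  have hnabla (a b : E) : fderiv ℝ φ y a b = G y (φ y a) (φ y b) • (∑ α, ξ α y) +
      β b • φ y (φ y a) - christoffel G y a (φ y b) + φ y (christoffel G y a b) := by
    rw [← L.nablaEnd_eq hy, nablaEnd_apply]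
    abel
  have hξ' (a : E) : ∑ α, G y (fderiv ℝ (ξ α) y a) u =
      -(e * G y (φ y a) u) - G y (christoffel G y a (∑ α, ξ α y)) u := by
    rw [he, Finset.sum_mul, map_sum, map_sum, sum_apply, ← Finset.sum_neg_distrib,
      ← Finset.sum_sub_distrib]
    refine Finset.sum_congr rfl fun α _ ↦ ?_
    have := congrArg (fun t ↦ G y t u) (L.nablaField_eq hy α a)
    simp only [nablaField_apply, map_add, add_apply, map_neg, neg_apply, map_smul, smul_apply,
      smul_eq_mul] at this
    linarith
  have hη' (a : E) : ∑ α, ε α * fderiv ℝ (η α) y a z =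
      β (christoffel G y a z) - e * G y (φ y a) z := by
    rw [he, Finset.sum_mul, hβ, ← Finset.sum_sub_distrib]
    refine Finset.sum_congr rfl fun α _ ↦ ?_
    have h1 := L.g_nablaField hy α a z
    rw [L.nablaField_eq hy] at h1
    simp only [map_neg, neg_apply, map_smul, smul_apply, smul_eq_mul] at h1
    linarith
  -- The formula for ∇φ differentiated along v and paired with u. Exchanging v and w and subtracting
  -- removes the second derivative of φ and the terms with Γ(·, ξ̄) or η̄(Γ(·, z)), which are
  -- symmetric.
  have key (v w : E) : G y (fderiv ℝ (fderiv ℝ φ) y v w z) u +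
      G y (fderiv ℝ (christoffel G) y v w (φ y z)) u -
      G y (christoffel G y w (christoffel G y v (φ y z))) u +
      G y (christoffel G y w (φ y (christoffel G y v z))) u +
      G y (christoffel G y v (φ y (christoffel G y w z))) u -
      G y (φ y (fderiv ℝ (christoffel G) y v w z)) u -
      G y (φ y (christoffel G y v (christoffel G y w z))) u +
      G y v z * G y (christoffel G y w (∑ α, ξ α y)) u + β (christoffel G y w z) * G y v u =
      -(e * G y w z * G y (φ y v) u) - G y w z * G y (christoffel G y v (∑ α, ξ α y)) u -
        β (christoffel G y v z) * G y w u + e * G y (φ y v) z * G y w u := by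
    have h1 := hasFDerivAt_congr_apply L.isOpen hy
      ((((hDφ.clm_apply (hasFDerivAt_const w y)).clm_apply (hasFDerivAt_const z y)).add
        ((hΓ.clm_apply (hasFDerivAt_const w y)).clm_apply
          (hφ.clm_apply (hasFDerivAt_const z y)))).sub
        (hφ.clm_apply ((hΓ.clm_apply (hasFDerivAt_const w y)).clm_apply (hasFDerivAt_const z y))))
      ((((hG.clm_apply (hφ.clm_apply (hasFDerivAt_const w y))).clm_apply
          (hφ.clm_apply (hasFDerivAt_const z y))).smul
          (HasFDerivAt.fun_sum (u := Finset.univ) fun α _ ↦ L.hasFDerivAt_ξ hy α)).add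
        ((HasFDerivAt.fun_sum (u := Finset.univ) fun α _ ↦
          ((L.hasFDerivAt_η hy α).clm_apply (hasFDerivAt_const z y)).const_mul (ε α)).smul
          (hφ.clm_apply (hφ.clm_apply (hasFDerivAt_const w y)))))
      (fun x hx ↦ L.nablaEnd_eq hx w z) v
    simp only [add_apply, sub_apply, ContinuousLinearMap.comp_apply,
      ContinuousLinearMap.flip_apply, zero_apply, map_zero, zero_add, smul_apply, sum_apply,
      ContinuousLinearMap.smulRight_apply, smul_eq_mul] at h1
    have h2 := congrArg (fun t ↦ G y t u) h1
    rw [hnabla v (christoffel G y w z), hnabla v z, hβz] at h2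
    simp only [map_add, map_sub, add_apply, sub_apply, map_smul, smul_apply, smul_eq_mul, hξu,
      huu, hη', hzz, zero_smul, mul_zero, map_zero, zero_apply] at h2
    rw [show G y (∑ α, fderiv ℝ (ξ α) y v) u = _ by rw [map_sum, sum_apply, hξ' v]] at h2
    change _ = _ + (β z * _ + _) at h2
    rw [hβz] at h2
    linarith
  have h1 := key v w
  have h2 := key w v
  rw [fderiv_fderiv_comm L.isOpen L.contDiff_φ hy v w] at h1
  simp only [localCurvature, map_sub, map_add, sub_apply, add_apply]
  linarith

end LocalSStructure

/-! ### Curvature-like tensors -/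

section CurvatureLike

/-- The pair symmetry of a tensor with the other symmetries of a curvature tensor. -/
theorem curvature_pair_symm {V : Type*} {K : V → V → V → V → ℝ}
    (skew₁ : ∀ v w z u, K v w z u = -K w v z u) (skew₂ : ∀ v w z u, K v w z u = -K v w u z)
    (bianchi : ∀ v w z u, K v w z u + K w z v u + K z v w u = 0) (v w z u : V) :
    K v w z u = K z u v w := by
  linarith [bianchi v w z u, bianchi w z u v, bianchi z u v w, bianchi u v w z, skew₁ z v w u,
    skew₂ w z v u, skew₁ u w z v, skew₂ z u w v, skew₂ u w z v, skew₂ v w z u, skew₁ v z u w,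
    skew₂ v z u w, skew₂ u v z w, skew₁ w u v z, skew₂ z v w u, skew₁ v w u z, skew₂ w z u v,
    skew₂ u v w z, skew₂ w u v z, skew₁ v z w u, skew₂ z u v w]

variable {V : Type*} [AddCommGroup V] [Module ℝ V]

/-- A Kähler-like curvature tensor on a subspace `H` vanishes on all planes once it does so on the
`J`-invariant ones. -/
theorem kaehler_curvature_eq_zero {K : V → V → V → V → ℝ} {J : V → V} {H : Submodule ℝ V}
    (lin₁ : ∀ w z u, IsLinearMap ℝ fun v ↦ K v w z u)
    (lin₂ : ∀ v z u, IsLinearMap ℝ fun w ↦ K v w z u)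
    (lin₃ : ∀ v w u, IsLinearMap ℝ fun z ↦ K v w z u)
    (lin₄ : ∀ v w z, IsLinearMap ℝ fun u ↦ K v w z u)
    (skew₁ : ∀ v w z u, K v w z u = -K w v z u) (skew₂ : ∀ v w z u, K v w z u = -K v w u z)
    (bianchi : ∀ v w z u, K v w z u + K w z v u + K z v w u = 0)
    (hJ : IsLinearMap ℝ J) (hJH : ∀ v ∈ H, J v ∈ H) (hJJ : ∀ v ∈ H, J (J v) = -v)
    (inv : ∀ v ∈ H, ∀ w ∈ H, ∀ z ∈ H, ∀ u ∈ H, K v w (J z) (J u) = K v w z u)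
    (holo : ∀ x ∈ H, K x (J x) (J x) x = 0) {x y z : V} (hx : x ∈ H) (hy : y ∈ H) (hz : z ∈ H) :
    K y x x z = 0 := by
  have pair := curvature_pair_symm skew₁ skew₂ bianchi
  have inv' (v w z u : V) (hv : v ∈ H) (hw : w ∈ H) (hz : z ∈ H) (hu : u ∈ H) :
      K (J v) (J w) z u = K v w z u := by
    rw [pair, inv z hz u hu v hv w hw, pair]
  have n₃ (v w z u : V) : K v w (-z) u = -K v w z u := (lin₃ v w u).map_neg z
  have n₂ (v w z u : V) : K v (-w) z u = -K v w z u := (lin₂ v z u).map_neg w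
  -- The part of the holomorphic curvature of x + y of degree two in each variable, isolated by
  -- adding the expansions at x + y and x - y.
  have six (x y : V) (hx : x ∈ H) (hy : y ∈ H) : K y (J y) (J x) x + K x (J x) (J y) y +
      K y (J x) (J y) x + K x (J y) (J x) y + K y (J x) (J x) y + K x (J y) (J y) x = 0 := by
    have h1 := holo _ (H.add_mem hx hy)
    have h2 := holo _ (H.sub_mem hx hy)
    simp only [hJ.map_add, (lin₁ _ _ _).map_add, (lin₂ _ _ _).map_add, (lin₃ _ _ _).map_add,
      (lin₄ _ _ _).map_add] at h1
    simp only [hJ.map_sub, (lin₁ _ _ _).map_sub, (lin₂ _ _ _).map_sub, (lin₃ _ _ _).map_sub,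
      (lin₄ _ _ _).map_sub] at h2
    linarith [holo x hx, holo y hy]
  -- With A = K(x, y, y, x) and B = K(x, Jy, Jy, x), J-invariance and the Bianchi identity reduce
  -- the six terms to 2(A + B) + 4B = 0.
  have sec (x y : V) (hx : x ∈ H) (hy : y ∈ H) : K x y y x = -3 * K x (J y) (J y) x := by
    have hJx := hJH x hx
    have hJy := hJH y hy
    have t1 : K x (J y) (J x) y = K x (J y) (J y) x := by
      rw [← inv x hx _ hJy _ hJx y hy, hJJ x hx, n₃, skew₂, neg_neg]
    have t2 : K y (J x) (J x) y = K x (J y) (J y) x := by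
      rw [← inv' y (J x) (J x) y hy hJx hJx hy, hJJ x hx, n₂, ← inv _ hJy x hx _ hJx y hy,
        hJJ x hx, n₃, neg_neg, skew₁, skew₂, neg_neg]
    have t3 : K y (J x) (J y) x = K x (J y) (J y) x := by
      rw [← t2, ← inv y hy _ hJx _ hJy x hx, hJJ y hy, n₃, skew₂, neg_neg]
    have t4 : K x (J x) (J y) y = K x y y x + K x (J y) (J y) x := by
      have h1 := bianchi x (J x) (J y) y
      rw [inv' x y x y hx hy hx hy, skew₁ (J y), t1] at h1
      linarith [skew₂ x y x y]
    have t5 : K y (J y) (J x) x = K x (J x) (J y) y := by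
      rw [pair, skew₁, skew₂, neg_neg]
    linarith [six x y hx hy]
  -- Replacing y by Jy exchanges A and B, so A = -3B and B = -3A, which forces A = 0.
  have zero (x y : V) (hx : x ∈ H) (hy : y ∈ H) : K x y y x = 0 := by
    have h1 := sec x y hx hy
    have h2 := sec x (J y) hx (hJH y hy)
    rw [hJJ y hy, n₂, n₃, neg_neg] at h2
    linarith
  have h1 := zero _ x (H.add_mem hy hz) hx
  simp only [(lin₁ _ _ _).map_add, (lin₄ _ _ _).map_add] at h1
  have h2 : K z x x y = K y x x z := by
    rw [pair, skew₁, skew₂, neg_neg]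
  linarith [zero y x hy hx, zero z x hz hx]

end CurvatureLike

/-! ### The curvature tensor of an `S`-space form on one tangent space -/

section SCurvature

variable {V : Type*} [AddCommGroup V] [Module ℝ V] [TopologicalSpace V] {s : ℕ}

/-- The algebraic properties of the curvature tensor `R` of an `S`-manifold of constant
`φ`-sectional curvature `c`. -/
structure IsSCurvature (ε : Fin s → ℝ) (g : V →L[ℝ] V →L[ℝ] ℝ) (φ : V →L[ℝ] V) (ξ : Fin s → V)
    (η : Fin s → V →L[ℝ] ℝ) (R : V → V → V → V) (c : ℝ) : Prop extends FFrame ε g φ ξ η where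
  lin₁ (w z : V) : IsLinearMap ℝ fun v ↦ R v w z
  lin₂ (v z : V) : IsLinearMap ℝ fun w ↦ R v w z
  lin₃ (v w : V) : IsLinearMap ℝ fun z ↦ R v w z
  swap (v w z : V) : R v w z = -R w v z
  bianchi (v w z : V) : R v w z + R w z v + R z v w = 0
  skew (v w z u : V) : g (R v w z) u = -g z (R v w u)
  curv_ξ (α : Fin s) (v w : V) : R v w (ξ α) =
    -(ε α • ((∑ β, ε β * η β w) • φ (φ v) - (∑ β, ε β * η β v) • φ (φ w)))
  curv_φ (v w z u : V) (hz : ∀ α, η α z = 0) (hu : ∀ α, η α u = 0) :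
    g (R v w (φ z)) u - g (φ (R v w z)) u = (∑ α, ε α) *
      (g (φ v) z * g w u - g w z * g (φ v) u - (g (φ w) z * g v u - g v z * g (φ w) u))
  holo (x : V) (hx : ∀ α, η α x = 0) : g (R x (φ x) (φ x)) x = c * g x x ^ 2

namespace IsSCurvature

variable {ε : Fin s → ℝ} {g : V →L[ℝ] V →L[ℝ] ℝ} {φ : V →L[ℝ] V} {ξ : Fin s → V}
  {η : Fin s → V →L[ℝ] ℝ} {R : V → V → V → V} {c : ℝ}

theorem pair_symm (h : IsSCurvature ε g φ ξ η R c) (v w z u : V) :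
    g (R v w z) u = g (R z u v) w := by
  refine curvature_pair_symm (K := fun v w z u ↦ g (R v w z) u) (fun v w z u ↦ ?_)
    (fun v w z u ↦ ?_) (fun v w z u ↦ ?_) v w z u
  · rw [h.swap, map_neg, neg_apply]
  · rw [h.skew, h.symm]
  · rw [← add_apply, ← add_apply, ← map_add, ← map_add, h.bianchi, map_zero, zero_apply]

theorem φφ_eq_neg (h : FFrame ε g φ ξ η) {x : V} (hx : ∀ α, η α x = 0) : φ (φ x) = -x := by
  simp [h.φ_sq, hx]

/-- The curvature tensor on the image of `φ`. -/
theorem curvature_horizontal (h : IsSCurvature ε g φ ξ η R c) {x y z : V} (hx : ∀ α, η α x = 0)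
    (hy : ∀ α, η α y = 0) (hz : ∀ α, η α z = 0) :
    g (R y x x) z = ((∑ α, ε α) + (c - ∑ α, ε α) / 4) * (g x x * g y z - g y x * g x z) -
      (c - ∑ α, ε α) / 4 * (3 * (g (φ y) x * g (φ x) z)) := by
  set e := ∑ α, ε α
  have hF := h.toFFrame
  let H : Submodule ℝ V := ⨅ α, LinearMap.ker (η α).toLinearMap
  have hH (v : V) : v ∈ H ↔ ∀ α, η α v = 0 := by simp [H]
  have gφ (v w : V) : g (φ v) w = -g (φ w) v := by rw [hF.g_φ, hF.symm]
  let A (v w z u : V) : ℝ := g w z * g v u - g v z * g w u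
  let B (v w z u : V) : ℝ :=
    g (φ w) z * g (φ v) u - g (φ v) z * g (φ w) u - 2 * (g (φ v) w * g (φ z) u)
  -- `A` is the tensor of constant curvature 1, and `e * A` accounts for the failure of R to commute
  -- with φ. `A + B` is the complex space form tensor; it is φ-invariant with holomorphic curvature
  -- 4, and e + 4(c - e)/4 = c.
  let K (v w z u : V) : ℝ := g (R v w z) u - e * A v w z u - (c - e) / 4 * (A v w z u + B v w z u)
  have key : K y x x z = 0 := by
    refine kaehler_curvature_eq_zero (K := K) (J := φ) (H := H) ?_ ?_ ?_ ?_ ?_ ?_ ?_ ?_ ?_ ?_ ?_ ?_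
      ((hH x).2 hx) ((hH y).2 hy) ((hH z).2 hz)
    · refine fun w z u ↦ ⟨fun a b ↦ ?_, fun r a ↦ ?_⟩
      · simp only [K, A, B, (h.lin₁ w z).map_add, map_add, add_apply]
        ring
      · simp only [K, A, B, (h.lin₁ w z).map_smul, map_smul, smul_apply, smul_eq_mul]
        ring
    · refine fun v z u ↦ ⟨fun a b ↦ ?_, fun r a ↦ ?_⟩
      · simp only [K, A, B, (h.lin₂ v z).map_add, map_add, add_apply]
        ring
      · simp only [K, A, B, (h.lin₂ v z).map_smul, map_smul, smul_apply, smul_eq_mul]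
        ring
    · refine fun v w u ↦ ⟨fun a b ↦ ?_, fun r a ↦ ?_⟩
      · simp only [K, A, B, (h.lin₃ v w).map_add, map_add, add_apply]
        ring
      · simp only [K, A, B, (h.lin₃ v w).map_smul, map_smul, smul_apply, smul_eq_mul]
        ring
    · refine fun v w z ↦ ⟨fun a b ↦ ?_, fun r a ↦ ?_⟩
      · simp only [K, A, B, map_add]
        ring
      · simp only [K, A, B, map_smul, smul_eq_mul]
        ring
    · intro v w z u
      simp only [K, A, B]
      rw [h.swap v w z, gφ w v, map_neg, neg_apply]
      ring
    · intro v w z u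
      simp only [K, A, B]
      rw [h.skew v w z u, hF.symm z, gφ u z]
      ring
    · intro v w z u
      have h1 := congrArg (fun t ↦ g t u) (h.bianchi v w z)
      simp only [map_add, add_apply, map_zero, zero_apply] at h1
      simp only [K, A, B]
      rw [gφ w v, gφ z v, gφ z w, hF.symm w v, hF.symm z v, hF.symm z w]
      linear_combination h1
    · exact ⟨map_add _, map_smul _⟩
    · exact fun v _ ↦ (hH _).2 fun α ↦ hF.η_φ α v
    · exact fun v hv ↦ φφ_eq_neg hF ((hH v).1 hv)
    · intro v hv w hw z hz u hu
      rw [hH] at hv hw hz hu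
      have h1 := h.curv_φ v w z (φ u) hz fun α ↦ hF.η_φ α u
      have c1 (a : V) : g (φ a) (φ u) = g a u := by simp [hF.compatible, hu]
      have c2 (a : V) : g (φ a) (φ z) = g a z := by simp [hF.compatible, hz]
      have c3 (a b : V) : g a (φ b) = -g (φ a) b := by rw [hF.g_φ, neg_neg]
      simp only [K, A, B]
      simp only [c1] at h1
      simp only [c1, c2, φφ_eq_neg hF hz, map_neg, neg_apply]
      simp only [c3] at h1 ⊢
      linear_combination h1
    · intro x hx
      rw [hH] at hx
      have h1 := h.holo x hx
      have c1 : g (φ x) (φ x) = g x x := by simp [hF.compatible, hx]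
      have c2 : g (φ x) x = 0 := by linarith [gφ x x]
      have c3 : g x (φ x) = 0 := by rw [hF.symm, c2]
      simp only [K, A, B, φφ_eq_neg hF hx, map_neg, neg_apply, c1, c2, c3, h1]
      ring
  have c2 : g (φ x) x = 0 := by linarith [gφ x x]
  simp only [K, A, B, c2] at key
  linear_combination key

/-- The curvature operator `y ↦ R(y, x) x` on the image of `φ`. -/
theorem curvature_horizontal_eq (h : IsSCurvature ε g φ ξ η R c) {x y : V}
    (hx : ∀ α, η α x = 0) (hxx : g x x = 1) (hy : ∀ α, η α y = 0) :
    R y x x = ((∑ α, ε α) + (c - ∑ α, ε α) / 4) • (y - g y x • x) -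
      (3 * ((c - ∑ α, ε α) / 4) * g (φ y) x) • φ x := by
  have hF := h.toFFrame
  refine sub_eq_zero.1 (hF.nondegenerate _ fun z ↦ ?_)
  -- On Im φ this is `curvature_horizontal`; along ξ_α both sides vanish, by `curv_ξ` and skewness.
  refine hF.linear_eq_zero (g _).toLinearMap (fun z ↦ ?_) (fun α ↦ ?_) z
  · have := h.curvature_horizontal hx hy (z := φ z) fun α ↦ hF.η_φ α z
    simp only [ContinuousLinearMap.coe_coe, map_sub, map_smul, sub_apply, smul_apply, smul_eq_mul,
      this, hxx]
    ring
  · have h1 : g (R y x x) (ξ α) = 0 := by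
      rw [h.skew, h.curv_ξ]
      simp [hx, hy]
    simp [h1, hF.g_ξ, hx, hy, hF.η_φ]

/-- Expansion into four terms. Those containing ξ_α come from `curv_ξ`, directly or through pair
symmetry; only R(y, x)x requires the horizontal curvature. -/
theorem jacobi_horizontal (h : IsSCurvature ε g φ ξ η R c) {α : Fin s} (hα : ε α = -1) {x y : V}
    (hx : ∀ β, η β x = 0) (hy : ∀ β, η β y = 0) :
    R y (ξ α + x) (ξ α + x) = y + g y x • ∑ β, ξ β + R y x x := by
  have hF := h.toFFrame
  have hb : ∑ β, ε β * η β (ξ α) = -1 := by simp [hF.η_ξ, hα]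
  have h1 : R y (ξ α) (ξ α) = y := by
    rw [h.curv_ξ, hb, hα, φφ_eq_neg hF hy, hF.φ_ξ]
    simp
  have h2 : R y x (ξ α) = 0 := by
    rw [h.curv_ξ]
    simp [hx, hy]
  have h3 : R y (ξ α) x = g y x • ∑ β, ξ β := by
    refine hF.ext fun z ↦ ?_
    rw [h.pair_symm, h.skew, h.curv_ξ, hα, φφ_eq_neg hF hx]
    simp [hx, hF.g_ξ', mul_comm]
  rw [(h.lin₂ _ _).map_add, (h.lin₃ _ _).map_add, (h.lin₃ _ _).map_add, h1, h2, h3]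
  abel

/-- With α = 0 the value is u plus the sum of the remaining ξ_γ; modulo u it no longer depends on β,
whence the all-ones block. -/
theorem jacobi_ξ (h : IsSCurvature ε g φ ξ η R c) {α β : Fin s} (hα : ε α = -1) (hβ : ε β = 1)
    {x : V} (hx : ∀ γ, η γ x = 0) (hxx : g x x = 1) :
    R (ξ β) (ξ α + x) (ξ α + x) = x + ∑ γ, ξ γ := by
  have hF := h.toFFrame
  have h1 : R (ξ β) (ξ α) (ξ α) = 0 := by
    rw [h.curv_ξ]
    simp [hF.φ_ξ]
  have h2 : R (ξ β) x (ξ α) = x := by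
    have hb : ∑ γ, ε γ * η γ (ξ β) = 1 := by simp [hF.η_ξ, hβ]
    rw [h.curv_ξ, hb, hα, hF.φ_ξ, φφ_eq_neg hF hx]
    simp
  have h3 : R (ξ β) (ξ α) x = 0 := by
    refine hF.ext fun z ↦ ?_
    rw [h.pair_symm, h.curv_ξ]
    simp [hF.g_ξ, hF.η_φ]
  have h4 : R (ξ β) x x = ∑ γ, ξ γ := by
    refine hF.ext fun z ↦ ?_
    rw [h.pair_symm, h.curv_ξ, hβ, φφ_eq_neg hF hx]
    simp [hx, hxx, hF.g_ξ']
  rw [(h.lin₂ _ _).map_add, (h.lin₃ _ _).map_add, (h.lin₃ _ _).map_add, h1, h2, h3, h4]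
  abel

end IsSCurvature

end SCurvature

open Module

/-! ### The characteristic polynomial of the Jacobi operator -/

section Charpoly

theorem charpoly_smul_id {W : Type*} [AddCommGroup W] [Module ℝ W] [FiniteDimensional ℝ W] (r : ℝ) :
    (r • (LinearMap.id : W →ₗ[ℝ] W)).charpoly =
      (Polynomial.X - Polynomial.C r) ^ finrank ℝ W := by
  have h : LinearMap.toMatrix (finBasis ℝ W) (finBasis ℝ W) (r • (LinearMap.id : W →ₗ[ℝ] W)) =
      Matrix.diagonal fun _ ↦ r := by
    rw [map_smul, LinearMap.toMatrix_id, Matrix.smul_one_eq_diagonal]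
  rw [← LinearMap.charpoly_toMatrix _ (finBasis ℝ W), h, Matrix.charpoly_diagonal]
  simp

theorem isRoot_jacobi_charpoly {n s : ℕ} (hn : 1 ≤ n) (hs : 1 ≤ s) (a b μ : ℝ) :
    ((Polynomial.X - Polynomial.C a) * (Polynomial.X - Polynomial.C b) ^ (2 * n - 2) *
      (if s = 1 then 1
        else Polynomial.X ^ (s - 2) * (Polynomial.X - Polynomial.C ((s : ℝ) - 1)))).IsRoot μ ↔
      μ = a ∨ (2 ≤ n ∧ μ = b) ∨ (2 ≤ s ∧ μ = s - 1) ∨ (3 ≤ s ∧ μ = 0) := by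
  -- A factor with exponent 0 has no root; hence the conditions 2 ≤ n and, below, 3 ≤ s.
  have h1 : 2 * n - 2 ≠ 0 ↔ 2 ≤ n := by omega
  rcases eq_or_ne s 1 with rfl | hs1
  · simp [sub_eq_zero, h1, and_comm]
  · have h2 : s - 2 ≠ 0 ↔ 3 ≤ s := by omega
    have h3 : 2 ≤ s := by omega
    simp only [hs1, if_false, Polynomial.IsRoot.def, Polynomial.eval_mul, Polynomial.eval_pow,
      Polynomial.eval_sub, Polynomial.eval_X, Polynomial.eval_C, mul_eq_zero, sub_eq_zero,
      pow_eq_zero_iff', h1, h2, h3, true_and]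
    tauto

variable {V : Type*} [AddCommGroup V] [Module ℝ V] [TopologicalSpace V] {s : ℕ}
  {ε : Fin s → ℝ} {g : V →L[ℝ] V →L[ℝ] ℝ} {φ : V →L[ℝ] V} {ξ : Fin s → V}
  {η : Fin s → V →L[ℝ] ℝ} {R : V → V → V → V} {c : ℝ}

/-- The vectors of the image of `φ` that are orthogonal to `x` and `φ x`. -/
def horizontalPerp (g : V →L[ℝ] V →L[ℝ] ℝ) (φ : V →L[ℝ] V) (η : Fin s → V →L[ℝ] ℝ) (x : V) :
    Submodule ℝ V :=
  (⨅ α, LinearMap.ker (η α).toLinearMap) ⊓ LinearMap.ker (g x).toLinearMap ⊓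
    LinearMap.ker (g (φ x)).toLinearMap

theorem mem_horizontalPerp {x w : V} :
    w ∈ horizontalPerp g φ η x ↔ ((∀ α, η α w = 0) ∧ g x w = 0) ∧ g (φ x) w = 0 := by
  simp [horizontalPerp]

/-- Coordinates on `u^⊥`, modulo `u = ξ 0 + x`. -/
def jacobiCoord [NeZero s] (g : V →L[ℝ] V →L[ℝ] ℝ) (φ : V →L[ℝ] V) (ξ : Fin s → V)
    (η : Fin s → V →L[ℝ] ℝ) (x : V) :
    (ℝ × horizontalPerp g φ η x × ({β : Fin s // β ≠ 0} → ℝ)) →ₗ[ℝ] V :=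
  (LinearMap.toSpanSingleton ℝ V (φ x)).coprod
    ((horizontalPerp g φ η x).subtype.coprod (Fintype.linearCombination ℝ fun β ↦ ξ β.1))

theorem jacobiCoord_apply [NeZero s] (x : V) (a : ℝ) (w : horizontalPerp g φ η x)
    (b : {β : Fin s // β ≠ 0} → ℝ) :
    jacobiCoord g φ ξ η x (a, w, b) = a • φ x + (w + ∑ β, b β • ξ β.1) := by
  simp [jacobiCoord, Fintype.linearCombination_apply]

namespace IsSCurvature

/-- `jacobiCoord` induces an isomorphism onto u^⊥/⟨u⟩ that conjugates the Jacobi operator to a block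
diagonal one. The bound 1 ≤ n comes from the dimension count, since x and φx are independent. -/
theorem charpoly_jacobi [NeZero s] [FiniteDimensional ℝ V] (h : IsSCurvature ε g φ ξ η R c)
    (hε0 : ε 0 = -1) (hε : ∀ β, β ≠ 0 → ε β = 1) {n : ℕ} (hdim : finrank ℝ V = 2 * n + s)
    {x : V} (hx : ∀ α, η α x = 0) (hxx : g x x = 1) {T : V →ₗ[ℝ] V}
    (hT : ∀ v, T v = R v (ξ 0 + x) (ξ 0 + x)) {P : Submodule ℝ V}
    (hP : P = LinearMap.ker (g (ξ 0 + x)).toLinearMap) {N : Submodule ℝ P}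
    (hN : N = (Submodule.span ℝ {ξ 0 + x}).submoduleOf P) (hTP : ∀ v ∈ P, T v ∈ P)
    (hTN : N ≤ N.comap (T.restrict hTP)) :
    1 ≤ n ∧ (N.mapQ N (T.restrict hTP) hTN).charpoly =
      (Polynomial.X - Polynomial.C (c + 1)) *
        (Polynomial.X - Polynomial.C ((c + 3 * s - 2) / 4)) ^ (2 * n - 2) *
        (if s = 1 then 1
          else Polynomial.X ^ (s - 2) * (Polynomial.X - Polynomial.C ((s : ℝ) - 1))) := by
  have hF := h.toFFrame
  set u := ξ 0 + x with hu
  have hs : 1 ≤ s := Nat.one_le_iff_ne_zero.2 (NeZero.ne s)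
  have hcard : Fintype.card {β : Fin s // β ≠ 0} = s - 1 := by
    simp
  have he : ∑ α, ε α = (s : ℝ) - 2 := by
    rw [← Finset.add_sum_erase _ _ (Finset.mem_univ 0), hε0,
      Finset.sum_congr rfl fun β hβ ↦ hε β (Finset.ne_of_mem_erase hβ)]
    simp [Nat.cast_sub hs]
    ring
  have hsumξ : ∑ γ, ξ γ = ξ 0 + ∑ β : {β : Fin s // β ≠ 0}, ξ β.1 := by
    rw [← Finset.add_sum_erase _ _ (Finset.mem_univ 0)]
    congr 1
    exact Finset.sum_subtype _ (by simp) _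
  have hgu (v : V) : g u v = -η 0 v + g x v := by
    simp [hu, hF.g_ξ', hε0]
  have hmemP (v : V) : v ∈ P ↔ g x v = η 0 v := by
    rw [hP, LinearMap.mem_ker]
    change g u v = 0 ↔ _
    rw [hgu]
    constructor <;> intro <;> linarith
  have hmemN (v : P) : v ∈ N ↔ ∃ t : ℝ, t • u = v := by
    rw [hN]
    exact Submodule.mem_span_singleton
  have hxφ : g x (φ x) = 0 := by linarith [hF.g_φ x x, hF.symm x (φ x)]
  have hφx : g (φ x) (φ x) = 1 := by simp [hF.compatible, hx, hxx]
  have hgξ (β : Fin s) (v : V) (hv : ∀ α, η α v = 0) : g v (ξ β) = 0 := by simp [hF.g_ξ, hv]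
  have hη (β : {β : Fin s // β ≠ 0}) : η 0 (ξ β.1) = 0 := by
    rw [hF.η_ξ, if_neg (Ne.symm β.2)]
  have h00 : η 0 (ξ 0) = 1 := by simp [hF.η_ξ]
  have hLP (q : ℝ × horizontalPerp g φ η x × ({β : Fin s // β ≠ 0} → ℝ)) :
      jacobiCoord g φ ξ η x q ∈ P := by
    obtain ⟨a, w, b⟩ := q
    have hw := mem_horizontalPerp.1 w.2
    rw [jacobiCoord_apply, hmemP]
    simp [hw.1.1, hw.1.2, hxφ, hgξ _ x hx, hF.η_φ, hη]
  let L := N.mkQ ∘ₗ (jacobiCoord g φ ξ η x).codRestrict P hLP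
  have hLbij : Function.Bijective L := by
    refine ⟨(injective_iff_map_eq_zero L).2 ?_, fun y ↦ ?_⟩
    · rintro ⟨a, w, b⟩ hq
      have hw := mem_horizontalPerp.1 w.2
      obtain ⟨t, ht⟩ := (hmemN _).1 ((Submodule.Quotient.mk_eq_zero N).1 hq)
      replace ht : t • (ξ 0 + x) = a • φ x + (w + ∑ β, b β • ξ β.1) :=
        ht.trans (jacobiCoord_apply x a w b)
      -- The relation is tested against η^0, then g(φx, ·), then η^β; each isolates one coefficient.
      have ht0 : t = 0 := by
        have := congrArg (η 0) ht
        simpa [h00, hx, hw.1.1, hF.η_φ, hη] using this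
      rw [ht0, zero_smul] at ht
      have ha : a = 0 := by
        have := congrArg (g (φ x)) ht
        simpa [hφx, hw.2, hgξ _ (φ x) (fun α ↦ hF.η_φ α x), eq_comm] using this
      have hb (β : {β : Fin s // β ≠ 0}) : b β = 0 := by
        have := congrArg (η β.1) ht
        simpa [hF.η_φ, hw.1.1, hF.η_ξ, Subtype.coe_inj, eq_comm] using this
      have hw0 : (w : V) = 0 := by simpa [ha, hb] using ht.symm
      rw [Prod.mk_eq_zero, Prod.mk_eq_zero]
      exact ⟨ha, Subtype.ext hw0, funext hb⟩
    · obtain ⟨⟨v, hv⟩, rfl⟩ := N.mkQ_surjective y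
      have hv' := (hmemP v).1 hv
      set p : V := -φ (φ v) with hp
      have hpη (α : Fin s) : η α p = 0 := by simp [hp, hF.η_φ]
      have hvp : v = p + ∑ α, η α v • ξ α := hF.eq_add v
      have hsum : ∑ α, η α v • ξ α =
          η 0 v • ξ 0 + ∑ β : {β : Fin s // β ≠ 0}, η β.1 v • ξ β.1 := by
        rw [← Finset.add_sum_erase _ _ (Finset.mem_univ 0)]
        congr 1
        exact Finset.sum_subtype _ (by simp) _
      have hxp : g x p = η 0 v := by
        rw [← hv', hvp]
        simp [hgξ _ x hx]
      -- The horizontal part of v without its components along x and φx.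
      let w : V := p - g x p • x - g (φ x) p • φ x
      have hw : w ∈ horizontalPerp g φ η x := by
        refine mem_horizontalPerp.2 ⟨⟨fun α ↦ ?_, ?_⟩, ?_⟩
        · simp [w, hpη, hx, hF.η_φ]
        · simp [w, hxx, hxφ]
        · simp [w, hφx, hF.symm (φ x) x, hxφ]
      refine ⟨(g (φ x) p, ⟨w, hw⟩, fun β ↦ η β.1 v), ?_⟩
      -- On u^⊥ the coefficients of x and of ξ_0 in v both equal η^0(v), so what the coordinates
      -- omit is η^0(v) u.
      refine (Submodule.Quotient.eq N).2 ((hmemN _).2 ⟨-η 0 v, ?_⟩)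
      change -η 0 v • (ξ 0 + x) = jacobiCoord g φ ξ η x _ - v
      rw [jacobiCoord_apply]
      conv_rhs => enter [2]; rw [hvp, hsum]
      simp only [w, hxp, neg_smul, smul_add]
      abel
  let D : Module.End ℝ (ℝ × horizontalPerp g φ η x × ({β : Fin s // β ≠ 0} → ℝ)) :=
    ((c + 1) • (LinearMap.id : ℝ →ₗ[ℝ] ℝ)).prodMap
      ((((c + 3 * s - 2) / 4) • (LinearMap.id : horizontalPerp g φ η x →ₗ[ℝ] _)).prodMap
        (Matrix.toLin' (Matrix.vecMulVec (fun _ : {β : Fin s // β ≠ 0} ↦ (1 : ℝ)) fun _ ↦ 1)))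
  have hTφ : T (φ x) = (c + 1) • φ x := by
    rw [hT, h.jacobi_horizontal hε0 hx fun α ↦ hF.η_φ α x,
      h.curvature_horizontal_eq hx hxx fun α ↦ hF.η_φ α x, hF.symm (φ x) x, hxφ,
      φφ_eq_neg hF hx]
    simp only [map_neg, neg_apply, hxx]
    module
  have hTw (w : V) (hw : w ∈ horizontalPerp g φ η x) : T w = ((c + 3 * s - 2) / 4) • w := by
    obtain ⟨⟨h1, h2⟩, h3⟩ := mem_horizontalPerp.1 hw
    rw [hT, h.jacobi_horizontal hε0 hx h1, h.curvature_horizontal_eq hx hxx h1, hF.symm w x, h2,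
      show g (φ w) x = 0 by rw [hF.g_φ, hF.symm, h3, neg_zero], he]
    module
  have hTξ (β : {β : Fin s // β ≠ 0}) :
      T (ξ β.1) = u + ∑ γ : {β : Fin s // β ≠ 0}, ξ γ.1 := by
    rw [hT, h.jacobi_ξ hε0 (hε _ β.2) hx hxx, hsumξ, hu]
    abel
  have hcomm (q) : N.mapQ N (T.restrict hTP) hTN (L q) = L (D q) := by
    obtain ⟨a, w, b⟩ := q
    -- Each ξ_β contributes one copy of u to T, by `hTξ`, so the discrepancy is (Σ b_β) u.
    refine (Submodule.Quotient.eq N).2 ((hmemN _).2 ⟨∑ β, b β, ?_⟩)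
    change _ = T (jacobiCoord g φ ξ η x (a, w, b)) - jacobiCoord g φ ξ η x
      ((c + 1) • a, ((c + 3 * s - 2) / 4) • w, Matrix.toLin' (Matrix.vecMulVec _ _) b)
    have hvec : Matrix.toLin' (Matrix.vecMulVec (fun _ : {β : Fin s // β ≠ 0} ↦ (1 : ℝ))
        fun _ ↦ 1) b = fun _ ↦ ∑ β, b β := by
      ext γ
      simp [Matrix.vecMulVec, Matrix.mulVec, dotProduct]
    rw [hvec, jacobiCoord_apply, jacobiCoord_apply]
    simp only [map_add, map_smul, map_sum, hTφ, hTw w w.2, hTξ, smul_add, Submodule.coe_smul,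
      Finset.sum_add_distrib, ← Finset.sum_smul, ← Finset.smul_sum]
    module
  let e := LinearEquiv.ofBijective L hLbij
  have hconj : e.conj D = N.mapQ N (T.restrict hTP) hTN := by
    refine LinearMap.ext fun y ↦ ?_
    obtain ⟨q, rfl⟩ := e.surjective y
    rw [LinearEquiv.conj_apply_apply, e.symm_apply_apply]
    exact (hcomm q).symm
  have hu0 : u ≠ 0 := fun h0 ↦ by
    have := congrArg (η 0) h0
    simp [hu, hF.η_ξ, hx] at this
  have huP : u ∈ P := by
    rw [hmemP]
    simp [hu, hF.η_ξ, hx, hgξ _ x hx, hxx]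
  -- Counting dimensions in the quotient: (2n + s) - 1 - 1 = 1 + dim + (s - 1).
  have hrank : finrank ℝ (horizontalPerp g φ η x) + 2 = 2 * n := by
    have h1 : finrank ℝ P + 1 = finrank ℝ V := by
      rw [hP]
      refine Module.Dual.finrank_ker_add_one_of_ne_zero (f := (g u).toLinearMap) fun h0 ↦ hu0 ?_
      exact hF.nondegenerate u fun w ↦ DFunLike.congr_fun h0 w
    have h2 : finrank ℝ N = 1 := by
      rw [hN, (Submodule.submoduleOfEquivOfLe
        ((Submodule.span_singleton_le_iff_mem u P).2 huP)).finrank_eq, finrank_span_singleton hu0]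
    have h3 := Submodule.finrank_quotient_add_finrank N
    have h4 := e.finrank_eq
    rw [finrank_prod, finrank_prod, finrank_fintype_fun_eq_card, hcard, finrank_self] at h4
    omega
  refine ⟨by omega, ?_⟩
  rw [← hconj, LinearEquiv.charpoly_conj, LinearMap.charpoly_prodMap, LinearMap.charpoly_prodMap,
    charpoly_smul_id, charpoly_smul_id, Matrix.charpoly_toLin', Matrix.charpoly_vecMulVec, hcard,
    finrank_self, pow_one, show finrank ℝ (horizontalPerp g φ η x) = 2 * n - 2 by omega,
    ← mul_assoc]
  congr 1
  -- A rank-one matrix of size k = s - 1 has characteristic polynomial X^k - (trace) X^(k-1), and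
  -- the trace is k here. For s = 1 the matrix is empty and the factor is 1.
  split_ifs with hs1
  · subst hs1
    simp [dotProduct]
  · obtain ⟨m, rfl⟩ : ∃ m, s = m + 2 := ⟨s - 2, by omega⟩
    have h2 : (Polynomial.C 2 : ℝ[X]) = 2 := map_ofNat _ 2
    simp [dotProduct, Polynomial.smul_eq_C_mul, h2]
    ring

end IsSCurvature

end Charpoly

/-- The values at `y` enter through equations because the chart components at the base point equal
the tensors at p only propositionally. -/
theorem LocalSStructure.isSCurvature {E : Type*} [NormedAddCommGroup E] [NormedSpace ℝ E]
    [FiniteDimensional ℝ E] {s : ℕ} [NeZero s] {U : Set E} {ε : Fin s → ℝ}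
    {G : E → E →L[ℝ] E →L[ℝ] ℝ} {φ : E → E →L[ℝ] E} {ξ : Fin s → E → E}
    {η : Fin s → E → E →L[ℝ] ℝ} (L : LocalSStructure U ε G φ ξ η) {y : E} (hy : y ∈ U) {c : ℝ}
    {g' : E →L[ℝ] E →L[ℝ] ℝ} {φ' : E →L[ℝ] E} {ξ' : Fin s → E} {η' : Fin s → E →L[ℝ] ℝ}
    (hg : G y = g') (hφ : φ y = φ') (hξ : (fun α ↦ ξ α y) = ξ') (hη : (fun α ↦ η α y) = η')
    (holo : ∀ x : E, (∀ α, η' α x = 0) →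
      g' (localCurvature G y x (φ' x) (φ' x)) x = c * g' x x ^ 2) :
    IsSCurvature ε g' φ' ξ' η' (localCurvature G y) c := by
  subst hg hφ hξ hη
  refine
    { toFFrame := L.fFrame hy
      lin₁ := fun w z ↦ ⟨fun a b ↦ ?_, fun r a ↦ ?_⟩
      lin₂ := fun v z ↦ ⟨fun a b ↦ ?_, fun r a ↦ ?_⟩
      lin₃ := fun v w ↦ ⟨fun a b ↦ ?_, fun r a ↦ ?_⟩
      swap := fun v w z ↦ LocalMetric.localCurvature_swap _ _ _ _ _
      bianchi := fun v w z ↦ L.localMetric.localCurvature_bianchi hy v w z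
      skew := fun v w z u ↦ L.localMetric.localCurvature_skew hy v w z u
      curv_ξ := fun α v w ↦ ?_
      curv_φ := fun v w z u hz hu ↦ L.localCurvature_φ hy v w hz hu
      holo := holo }
  · simp only [localCurvature, map_add, add_apply]
    abel
  · simp only [localCurvature, map_smul, smul_apply, smul_sub, smul_add]
  · simp only [localCurvature, map_add, add_apply]
    abel
  · simp only [localCurvature, map_smul, smul_apply, smul_sub, smul_add]
  · simp only [localCurvature, map_add]
    abel
  · simp only [localCurvature, map_smul, smul_sub, smul_add]
  · have h := L.localCurvature_ξ hy α v w
    rwa [L.nablaEnd_eq hy, L.nablaEnd_eq hy, L.symm hy (φ y w), add_sub_add_left_eq_sub] at h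

/-! ### From the chart back to the tangent space at the base point -/

section BasePoint

variable {E : Type*} [NormedAddCommGroup E] [NormedSpace ℝ E]
  {M : Type*} [TopologicalSpace M] [ChartedSpace E M]

/-- A field of elements of a type that is the same at all points has the same value at `p` and at
the preimage of `p` under the inverse of the chart. -/
theorem apply_extChartAt_symm_self {F : Type*} (f : M → F) (p : M) :
    f ((extChartAt 𝓘(ℝ, E) p).symm (extChartAt 𝓘(ℝ, E) p p)) = f p := by
  rw [extChartAt_to_inv]

variable [IsManifold 𝓘(ℝ, E) ∞ M]

/-- The model space serves as T_pM through the preferred chart at p itself. -/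
theorem chartFrame_self (p : M) :
    (chartFrame p (extChartAt 𝓘(ℝ, E) p p) : E →L[ℝ] E) = ContinuousLinearMap.id ℝ E := by
  have : IsManifold 𝓘(ℝ, E) 1 M := .of_le (n := ∞) (by simp)
  have h := mfderivWithin_range_extChartAt_symm (I := 𝓘(ℝ, E)) (x := p)
  rw [modelWithCornersSelf_coe, Set.range_id, mfderivWithin_univ] at h
  exact h

theorem chartCoframe_self (p : M) :
    (chartCoframe p (extChartAt 𝓘(ℝ, E) p p) : E →L[ℝ] E) = ContinuousLinearMap.id ℝ E := by
  have key (v : E) : (chartCoframe p (extChartAt 𝓘(ℝ, E) p p) : E →L[ℝ] E) v = v := by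
    have h := chartCoframe_chartFrame (E := E) p (mem_extChartAt_target (I := 𝓘(ℝ, E)) p) v
    have h' : (chartFrame p (extChartAt 𝓘(ℝ, E) p p) v : E) = v :=
      DFunLike.congr_fun (chartFrame_self (E := E) p) v
    exact (congrArg (chartCoframe p (extChartAt 𝓘(ℝ, E) p p) : E →L[ℝ] E) h').symm.trans h
  exact ContinuousLinearMap.ext key

theorem SemiRiemannianMetric.chartCoeff_self (g : SemiRiemannianMetric E M) (p : M) (v w : E) :
    g.chartCoeff p (extChartAt 𝓘(ℝ, E) p p) v w = g.val p v w := by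
  have hA := chartFrame_self (E := E) p
  have h1 : (chartFrame p (extChartAt 𝓘(ℝ, E) p p) v : E) = v := DFunLike.congr_fun hA v
  have h2 : (chartFrame p (extChartAt 𝓘(ℝ, E) p p) w : E) = w := DFunLike.congr_fun hA w
  have h3 := apply_extChartAt_symm_self (E := E) (F := E →L[ℝ] E →L[ℝ] ℝ) (fun q ↦ g.val q) p
  have h4 : g.chartCoeff p (extChartAt 𝓘(ℝ, E) p p) v w =
    (g.val ((extChartAt 𝓘(ℝ, E) p).symm (extChartAt 𝓘(ℝ, E) p p)) : E →L[ℝ] E →L[ℝ] ℝ)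
      (chartFrame p (extChartAt 𝓘(ℝ, E) p p) v : E)
      (chartFrame p (extChartAt 𝓘(ℝ, E) p p) w : E) := rfl
  refine h4.trans ?_
  rw [h1, h2]
  exact congrArg (fun B : E →L[ℝ] E →L[ℝ] ℝ ↦ B v w) h3

namespace IndefiniteGFF

variable {s : ℕ} (S : IndefiniteGFF E M s)

theorem chartφ_self (p : M) (v : E) : S.chartφ p (extChartAt 𝓘(ℝ, E) p p) v = S.φ p v := by
  have h1 : (chartFrame p (extChartAt 𝓘(ℝ, E) p p) v : E) = v :=
    DFunLike.congr_fun (chartFrame_self p) v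
  have h2 (a : E) : chartCoframe p (extChartAt 𝓘(ℝ, E) p p) a = a :=
    DFunLike.congr_fun (chartCoframe_self p) a
  have h3 := apply_extChartAt_symm_self (E := E) (F := E →L[ℝ] E) (fun q ↦ S.φ q) p
  have h4 : S.chartφ p (extChartAt 𝓘(ℝ, E) p p) v =
    (S.φ ((extChartAt 𝓘(ℝ, E) p).symm (extChartAt 𝓘(ℝ, E) p p)) : E →L[ℝ] E)
      (chartFrame p (extChartAt 𝓘(ℝ, E) p p) v : E) := h2 _
  refine h4.trans ?_
  rw [h1]
  exact congrArg (fun B : E →L[ℝ] E ↦ B v) h3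

theorem chartη_self (p : M) (α : Fin s) (v : E) :
    S.chartη p α (extChartAt 𝓘(ℝ, E) p p) v = S.η α p v := by
  have h1 : (chartFrame p (extChartAt 𝓘(ℝ, E) p p) v : E) = v :=
    DFunLike.congr_fun (chartFrame_self p) v
  have h3 := apply_extChartAt_symm_self (E := E) (F := E →L[ℝ] ℝ) (fun q ↦ S.η α q) p
  have h4 : S.chartη p α (extChartAt 𝓘(ℝ, E) p p) v =
    (S.η α ((extChartAt 𝓘(ℝ, E) p).symm (extChartAt 𝓘(ℝ, E) p p)) : E →L[ℝ] ℝ)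
      (chartFrame p (extChartAt 𝓘(ℝ, E) p p) v : E) := rfl
  refine h4.trans ?_
  rw [h1]
  exact congrArg (fun B : E →L[ℝ] ℝ ↦ B v) h3

theorem chartξ_self (p : M) (α : Fin s) :
    S.chartξ p α (extChartAt 𝓘(ℝ, E) p p) = S.ξ α p := by
  have h2 (a : E) : chartCoframe p (extChartAt 𝓘(ℝ, E) p p) a = a :=
    DFunLike.congr_fun (chartCoframe_self p) a
  exact (h2 _).trans (apply_extChartAt_symm_self (E := E) (F := E) (fun q ↦ S.ξ α q) p)

theorem fFrame (p : M) :
    FFrame S.ε (S.g.val p) (S.φ p) (fun α ↦ S.ξ α p) (fun α ↦ S.η α p) :=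
  have : Nonempty M := ⟨p⟩
  ⟨S.ε_mul_self, S.g.symm p, S.g.nondegenerate p, S.φ_sq p, S.φ_ξ p, S.η_ξ p, S.compatible p⟩

/-- On a Lorentz space the orthogonal complement of a timelike vector is positive definite. -/
theorem _root_.PhiNull.SemiRiemannianMetric.IsLorentz.pos_of_orthogonal
    {g : SemiRiemannianMetric E M} (hL : g.IsLorentz) {p : M} {t v : TangentSpace 𝓘(ℝ, E) p}
    (ht : g.val p t t < 0) (htv : g.val p t v = 0) (hv : v ≠ 0) : 0 < g.val p v v := by
  obtain ⟨z, hz, hpos⟩ := hL p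
  by_contra! hneg
  -- Otherwise t would lie in the positive definite hyperplane z^⊥.
  have htz : g.val p z t ≠ 0 := fun h0 ↦ by
    have := hpos t h0 fun h ↦ by simp [h] at ht
    linarith
  set a := g.val p z t
  set b := g.val p z v
  -- This combination is nonzero and orthogonal to z, hence spacelike; but if g(v, v) ≤ 0, its
  -- square a² g(v, v) + b² g(t, t) is not positive.
  have h1 : g.val p z (a • v - b • t) = 0 := by
    rw [map_sub, map_smul, map_smul, smul_eq_mul, smul_eq_mul]
    ring
  have h2 : g.val p (a • v - b • t) (a • v - b • t) =
      a ^ 2 * g.val p v v + b ^ 2 * g.val p t t := by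
    simp only [map_sub, map_smul, sub_apply, smul_apply, smul_eq_mul, htv, g.symm p v t]
    ring
  have h3 : a • v - b • t ≠ 0 := fun h0 ↦ by
    have h4 := congrArg (g.val p t) h0
    simp only [map_sub, map_smul, smul_eq_mul, htv, map_zero, mul_zero, zero_sub,
      neg_eq_zero, mul_eq_zero, ht.ne, or_false] at h4
    rw [h4, zero_smul, sub_zero, smul_eq_zero] at h0
    exact h0.elim htz hv
  have h5 := hpos _ h1 h3
  rw [h2] at h5
  nlinarith [mul_nonneg (sq_nonneg a) (neg_nonneg.2 hneg),
    mul_nonneg (sq_nonneg b) (neg_nonneg.2 ht.le)]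

variable [FiniteDimensional ℝ E] [NeZero s]

theorem isSCurvature (hS : S.IsSManifold) (hL : S.g.IsLorentz)
    (hξ : ∀ p : M, S.g.val p (S.ξ 0 p) (S.ξ 0 p) < 0) {c : ℝ}
    (hc : S.HasConstantPhiSectionalCurvature c) (p : M) :
    IsSCurvature S.ε (S.g.val p) (S.φ p) (fun α ↦ S.ξ α p) (fun α ↦ S.η α p)
      (S.g.curvature p) c := by
  have : Nonempty M := ⟨p⟩
  have hF := S.fFrame p
  have holo (x : TangentSpace 𝓘(ℝ, E) p) (hx : ∀ α, S.η α p x = 0) :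
      S.g.val p (S.g.curvature p x (S.φ p x) (S.φ p x)) x = c * S.g.val p x x ^ 2 := by
    -- Constancy of the sectional curvature says nothing about null x, but here x is orthogonal to
    -- the timelike ξ_0, so a null x is zero.
    rcases eq_or_ne (S.g.val p x x) 0 with h0 | h0
    · have hx0 : x = 0 := by
        by_contra hne
        have := hL.pos_of_orthogonal (hξ p) (by rw [hF.g_ξ' 0, hx, mul_zero]) hne
        exact this.ne' h0
      rw [hx0]
      simp [SemiRiemannianMetric.curvature, localCurvature]
    · have hr : x ∈ Set.range (S.φ p) :=
        ⟨-S.φ p x, by rw [map_neg, IsSCurvature.φφ_eq_neg hF hx, neg_neg]⟩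
      have h1 := hc p x hr h0
      have h2 : S.g.val p (S.φ p x) (S.φ p x) = S.g.val p x x := by
        rw [S.compatible]
        simp [hx]
      have h3 : S.g.val p x (S.φ p x) = 0 := by
        linarith [hF.g_φ x x, S.g.symm p x (S.φ p x)]
      rw [SemiRiemannianMetric.sectionalCurvature, h2, h3, div_eq_iff (by simpa using h0)] at h1
      rw [h1]
      ring
  exact (S.localSStructure hS p).isSCurvature (mem_extChartAt_target p)
    (ContinuousLinearMap.ext fun v ↦ ContinuousLinearMap.ext fun w ↦ S.g.chartCoeff_self p v w)
    (ContinuousLinearMap.ext fun v ↦ S.chartφ_self p v)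
    (funext fun α ↦ S.chartξ_self p α)
    (funext fun α ↦ ContinuousLinearMap.ext fun v ↦ S.chartη_self p α v) holo

theorem jacobi_spec (hS : S.IsSManifold) (hL : S.g.IsLorentz)
    (hξ : ∀ p : M, S.g.val p (S.ξ 0 p) (S.ξ 0 p) < 0) {c : ℝ}
    (hc : S.HasConstantPhiSectionalCurvature c) {n : ℕ} (hdim : Module.finrank ℝ E = 2 * n + s)
    (p : M) {u : TangentSpace 𝓘(ℝ, E) p} (hu : u ∈ S.phiNullCongruence 0 p) :
    1 ≤ n ∧ S.g.JacobiPreservesPerp p u ∧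
      (S.g.nullJacobi p u).charpoly =
        (Polynomial.X - Polynomial.C (c + 1)) *
          (Polynomial.X - Polynomial.C ((c + 3 * s - 2) / 4)) ^ (2 * n - 2) *
          (if s = 1 then 1
            else Polynomial.X ^ (s - 2) * (Polynomial.X - Polynomial.C ((s : ℝ) - 1))) := by
  have hF := S.fFrame p
  have h := S.isSCurvature hS hL hξ hc p
  obtain ⟨x, ⟨⟨-, hxx⟩, ⟨v, rfl⟩⟩, rfl⟩ := hu
  -- Skewness of R(z, u) gives g(R(z, u)u, u) = 0 for every z.
  have hP : S.g.JacobiPreservesPerp p (S.ξ 0 p + S.φ p v) := by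
    intro z _
    change S.g.val p _ (S.g.curvature p z _ _) = 0
    linarith [h.skew z (S.ξ 0 p + S.φ p v) (S.ξ 0 p + S.φ p v) (S.ξ 0 p + S.φ p v),
      S.g.symm p (S.g.curvature p z (S.ξ 0 p + S.φ p v) (S.ξ 0 p + S.φ p v))
        (S.ξ 0 p + S.φ p v)]
  have hε0 : S.ε 0 = -1 := by
    rcases S.ε_spec p 0 with h | h
    · linarith [hξ p]
    · exact h.1
  -- In Lorentz signature ξ_β, being nonzero and orthogonal to the timelike ξ_0, is spacelike.
  have hε (β : Fin s) (hβ : β ≠ 0) : S.ε β = 1 := by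
    rcases S.ε_spec p β with h | h
    · exact h.1
    · have h0 : S.g.val p (S.ξ 0 p) (S.ξ β p) = 0 := by
        rw [hF.g_ξ' 0, S.η_ξ, if_neg hβ.symm, mul_zero]
      have hne : S.ξ β p ≠ 0 := fun h1 ↦ by
        have := h.2
        rw [h1] at this
        simp at this
      linarith [hL.pos_of_orthogonal (hξ p) h0 hne]
  have : FiniteDimensional ℝ (TangentSpace 𝓘(ℝ, E) p) := inferInstanceAs (FiniteDimensional ℝ E)
  have key := h.charpoly_jacobi hε0 hε (n := n) hdim (x := S.φ p v) (fun α ↦ hF.η_φ α v) hxx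
    (T := S.g.jacobi p (S.ξ 0 p + S.φ p v)) (fun _ ↦ rfl) rfl rfl hP
    (S.g.lineInPerp_le_comap p _ hP)
  refine ⟨key.1, hP, ?_⟩
  rw [SemiRiemannianMetric.nullJacobi, dif_pos hP]
  exact key.2

end IndefiniteGFF

end BasePoint

end PhiNull

end

theorem theorem4p4 (n s : ℕ) [NeZero s]
    {M : Type*} [TopologicalSpace M] [T2Space M] [SecondCountableTopology M] [ConnectedSpace M]
    [ChartedSpace (EuclideanSpace ℝ (Fin (2 * n + s))) M]
    [IsManifold 𝓘(ℝ, EuclideanSpace ℝ (Fin (2 * n + s))) ∞ M]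
    (S : PhiNull.IndefiniteGFF (EuclideanSpace ℝ (Fin (2 * n + s))) M s)
    (hS : S.IsSManifold) (hL : S.g.IsLorentz)
    (hξ : ∀ p : M, S.g.val p (S.ξ 0 p) (S.ξ 0 p) < 0)
    (c : ℝ) (hc : S.HasConstantPhiSectionalCurvature c) :
    (∀ p : M, S.IsPhiNullOssermanAt 0 p) ∧
    S.IsGloballyPhiNullOsserman 0 ∧
    ∀ p : M, ∀ u ∈ S.phiNullCongruence 0 p,
      S.g.JacobiPreservesPerp p u ∧
      (S.g.nullJacobi p u).charpoly =
        (Polynomial.X - Polynomial.C (c + 1)) *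
          (Polynomial.X - Polynomial.C ((c + 3 * s - 2) / 4)) ^ (2 * n - 2) *
          (if s = 1 then 1
            else Polynomial.X ^ (s - 2) * (Polynomial.X - Polynomial.C ((s : ℝ) - 1))) ∧
      ∀ μ : ℝ, (S.g.nullJacobi p u).HasEigenvalue μ ↔
        μ = c + 1 ∨ (2 ≤ n ∧ μ = (c + 3 * s - 2) / 4) ∨
          (2 ≤ s ∧ μ = s - 1) ∨ (3 ≤ s ∧ μ = 0) := by
  have key (p : M) {u} (hu : u ∈ S.phiNullCongruence 0 p) :=
    S.jacobi_spec hS hL hξ hc (n := n) (by simp) p hu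
  have hat (p : M) : S.IsPhiNullOssermanAt 0 p := fun u hu v hv ↦ by
    rw [(key p hu).2.2, (key p hv).2.2]
  refine ⟨hat, ⟨hat, fun p q u hu v hv ↦ ?_⟩, fun p u hu ↦ ?_⟩
  · rw [(key p hu).2.2, (key q hv).2.2]
  · obtain ⟨hn, hP, hchar⟩ := key p hu
    refine ⟨hP, hchar, fun μ ↦ ?_⟩
    rw [Module.End.hasEigenvalue_iff_isRoot_charpoly, hchar]
    exact PhiNull.isRoot_jacobi_charpoly hn (Nat.one_le_iff_ne_zero.2 (NeZero.ne s)) _ _ μ
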